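/- Let $q,a\in\mathbb{C}$ with $0<|q|<1$ and $a\neq 0$. For $Q\in\mathbb{C}$ with $0<|Q|<1$ and $x,z\in\mathbb{C}\setminus\{0\}$ write $$(x;Q)_n=\prod_{i=0}^{n-1}(1-Q^ix),\qquad (x;Q)_\infty=\prod_{i\ge 0}(1-Q^ix),\qquad (x,y;Q)_n=(x;Q)_n(y;Q)_n,$$ $$j(x;Q)=(x;Q)_\infty(Q/x;Q)_\infty(Q;Q)_\infty,\qquad J_m=\prod_{i\ge 1}(1-q^{mi})\quad(m\ge 1),$$ $$m(x,Q,z)=\frac{1}{j(z;Q)}\sum_{r=-\infty}^{\infty}\frac{(-1)^rQ^{r(r-1)/2}z^r}{1-Q^{r-1}xz},\qquad g(x,Q)=x^{-1}\Big(-1+\sum_{n=0}^{\infty}\frac{Q^{n^2}}{(x;Q)_{n+1}(Q/x;Q)_n}\Big),$$ whenever no denominator vanishes. Then the following hold (in each case the series on the left converges absolutely). (A) If $a^4\neq q^{4k}$ for every integer $k$ (equivalently, no denominator below vanishes), then $$\sum_{n=0}^{\infty}q^{2n+1}(-aq,-q/a;q^2)_n=-q\,g(-aq,q^2)+a\,\frac{j(-aq;q^2)}{J_2}\,m(a^2,q^2,-1)-\frac12\,\frac{a\,j(aq;q^2)^3\,j(a^2;q^4)}{J_4^2\,j(a^4;q^4)}.$$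 (B) If $a\neq -q^{2k+1}$ for every integer $k$ (equivalently, no denominator below vanishes), then $$\sum_{n=0}^{\infty}q^{2n+1}(-aq,-q/a;q^2)_n=-q\,g(-aq,q^2)+a\,\frac{j(-aq;q^2)}{J_2}\,m(a^2,q^2,-a^{-1}q).$$ -/

import Mathlib

namespace QSeries

open Filter Topology

/-- The finite `q`-shifted factorial `(x; q)_n = ∏_{i=0}^{n-1} (1 - q^i x)`. -/
noncomputable def qPoch (x q : ℂ) (n : ℕ) : ℂ :=
  ∏ i ∈ Finset.range n, (1 - q ^ i * x)

/-- The infinite `q`-shifted factorial `(x; q)_∞ = ∏_{i ≥ 0} (1 - q^i x)`. -/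
noncomputable def qPochInf (x q : ℂ) : ℂ :=
  ∏' i : ℕ, (1 - q ^ i * x)

/-- The theta function `j(x; q) = (x; q)_∞ (q/x; q)_∞ (q; q)_∞`. -/
noncomputable def jTheta (x q : ℂ) : ℂ :=
  qPochInf x q * qPochInf (q / x) q * qPochInf q q

/-- `J_m = ∏_{i ≥ 1} (1 - q^{m i})`. -/
noncomputable def bigJ (m : ℕ) (q : ℂ) : ℂ :=
  ∏' i : ℕ, (1 - q ^ (m * (i + 1)))

/-- The general term of the bilateral series in the Appell--Lerch sum. The integer `r (r - 1)` is
even, so that the integer division is exact. -/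
noncomputable def appellLerchTerm (x q z : ℂ) (r : ℤ) : ℂ :=
  (-1) ^ r * q ^ (r * (r - 1) / 2) * z ^ r / (1 - q ^ (r - 1) * x * z)

/-- The Appell--Lerch sum
`m(x, q, z) = j(z; q)⁻¹ ∑_{r ∈ ℤ} (-1)^r q^{r(r-1)/2} z^r / (1 - q^{r-1} x z)`. -/
noncomputable def appellLerch (x q z : ℂ) : ℂ :=
  1 / jTheta z q * ∑' r : ℤ, appellLerchTerm x q z r

/-- The general term of the series in the universal mock theta function. -/
noncomputable def mockGTerm (x q : ℂ) (n : ℕ) : ℂ :=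
  q ^ (n ^ 2) / (qPoch x q (n + 1) * qPoch (q / x) q n)

/-- The universal mock theta function
`g(x, q) = x⁻¹ (-1 + ∑_{n ≥ 0} q^{n²} / ((x; q)_{n+1} (q/x; q)_n))`. -/
noncomputable def mockG (x q : ℂ) : ℂ :=
  x⁻¹ * (-1 + ∑' n : ℕ, mockGTerm x q n)

/-- The infinite product `(x; q)_∞` converges for `|q| < 1`. -/
theorem multipliable_qPochInf {q : ℂ} (hq : ‖q‖ < 1) (x : ℂ) :
    Multipliable fun i : ℕ => 1 - q ^ i * x := by
  have h : Summable fun i : ℕ => ‖-(q ^ i * x)‖ := by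
    have := (summable_geometric_of_lt_one (norm_nonneg q) hq).mul_right ‖x‖
    simpa [norm_neg, norm_mul, norm_pow] using this
  simpa [sub_eq_add_neg] using multipliable_one_add_of_summable h

/-- The product defining `J_m` converges for `|q| < 1` and `m ≥ 1`. -/
theorem multipliable_bigJ {q : ℂ} (hq : ‖q‖ < 1) {m : ℕ} (hm : 1 ≤ m) :
    Multipliable fun i : ℕ => 1 - q ^ (m * (i + 1)) := by
  have hqm : ‖q ^ m‖ < 1 := by
    rw [norm_pow]; exact pow_lt_one₀ (norm_nonneg q) hq (by omega)
  refine (multipliable_qPochInf hqm (q ^ m)).congr fun i => ?_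
  rw [← pow_mul, ← pow_add]; ring_nf

/-- The series in the definition of `g(x, q)` converges whenever its terms have nonzero
denominators. -/
theorem summable_mockGTerm {x q : ℂ} (hq0 : q ≠ 0) (hq : ‖q‖ < 1)
    (h : ∀ n : ℕ, 1 - q ^ n * x ≠ 0) (h' : ∀ n : ℕ, 1 - q ^ n * (q / x) ≠ 0) :
    Summable (mockGTerm x q) := by
  have hp (n : ℕ) : qPoch x q n ≠ 0 := Finset.prod_ne_zero_iff.2 fun i _ => h i
  have hp' (n : ℕ) : qPoch (q / x) q n ≠ 0 := Finset.prod_ne_zero_iff.2 fun i _ => h' i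
  have hne (n : ℕ) : mockGTerm x q n ≠ 0 :=
    div_ne_zero (pow_ne_zero _ hq0) (mul_ne_zero (hp _) (hp' _))
  have h0 : Tendsto (fun n : ℕ => q ^ n) atTop (𝓝 0) := tendsto_pow_atTop_nhds_zero_of_norm_lt_one hq
  refine summable_of_ratio_test_tendsto_lt_one (l := 0) one_pos (.of_forall hne) ?_
  have key : Tendsto (fun n : ℕ => q ^ n * q ^ n * q /
      ((1 - q ^ n * q * x) * (1 - q ^ n * (q / x)))) atTop (𝓝 0) := by
    have := (((h0.mul h0).mul_const q).div
      ((((h0.mul_const q).mul_const x).const_sub 1).mul ((h0.mul_const (q / x)).const_sub 1))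
      (by simp))
    simpa [Pi.div_def] using this
  rw [← norm_zero (E := ℂ)]
  refine key.norm.congr fun n => ?_
  rw [← norm_div]
  congr 1
  have e1 : qPoch x q (n + 1 + 1) = qPoch x q (n + 1) * (1 - q ^ n * q * x) := by
    rw [qPoch, Finset.prod_range_succ, ← qPoch, pow_succ]
  have e2 : qPoch (q / x) q (n + 1) = qPoch (q / x) q n * (1 - q ^ n * (q / x)) := by
    rw [qPoch, Finset.prod_range_succ, ← qPoch]
  have e3 : q ^ ((n + 1) ^ 2) = q ^ (n ^ 2) * (q ^ n * q ^ n * q) := by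
    rw [← pow_add, ← pow_succ, ← pow_add]; congr 1; ring
  rw [mockGTerm, mockGTerm, e1, e2, e3]
  have := hp (n + 1)
  have := hp' n
  have := pow_ne_zero (n ^ 2) hq0
  have a1 : 1 - q ^ n * q * x ≠ 0 := by simpa [pow_succ] using h (n + 1)
  have a2 := h' n
  generalize 1 - q ^ n * q * x = A at *
  generalize 1 - q ^ n * (q / x) = B at *
  field_simp

/-- The bilateral series in the definition of `m(x, q, z)` converges whenever its terms have
nonzero denominators. -/
theorem summable_appellLerchTerm {x q z : ℂ} (hq0 : q ≠ 0) (hq : ‖q‖ < 1) (hx : x ≠ 0)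
    (hz : z ≠ 0) (h : ∀ r : ℤ, 1 - q ^ r * x * z ≠ 0) :
    Summable (appellLerchTerm x q z) := by
  have hne (r : ℤ) : appellLerchTerm x q z r ≠ 0 :=
    div_ne_zero (mul_ne_zero (mul_ne_zero (zpow_ne_zero _ (by norm_num)) (zpow_ne_zero _ hq0))
      (zpow_ne_zero _ hz)) (h _)
  have hstep (r : ℤ) : appellLerchTerm x q z (r + 1) / appellLerchTerm x q z r =
      -(q ^ r * z) * (1 - q ^ (r - 1) * x * z) / (1 - q ^ r * x * z) := by
    have e : (r + 1) * (r + 1 - 1) / 2 = r * (r - 1) / 2 + r := by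
      rw [show (r + 1) * (r + 1 - 1) = r * (r - 1) + r * 2 by ring]
      exact Int.add_mul_ediv_right _ _ two_ne_zero
    rw [appellLerchTerm, appellLerchTerm, e, zpow_add₀ hq0, zpow_add₀ hz,
      zpow_add₀ (by norm_num : (-1 : ℂ) ≠ 0), add_sub_cancel_right, zpow_one, zpow_one]
    have b1 := h (r - 1)
    have b2 := h r
    have b3 : ((-1 : ℂ)) ^ r ≠ 0 := zpow_ne_zero _ (by norm_num)
    have b4 := zpow_ne_zero (r * (r - 1) / 2) hq0
    have b5 := zpow_ne_zero r hz
    generalize 1 - q ^ (r - 1) * x * z = A at *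
    generalize 1 - q ^ r * x * z = B at *
    field_simp
  have h0 : Tendsto (fun n : ℕ => q ^ n) atTop (𝓝 0) := tendsto_pow_atTop_nhds_zero_of_norm_lt_one hq
  refine Summable.of_nat_of_neg ?_ ?_
  · refine summable_of_ratio_test_tendsto_lt_one (l := 0) one_pos (.of_forall fun n => hne _) ?_
    have key : Tendsto (fun n : ℕ => -(q ^ n * z) * (1 - q ^ n * q⁻¹ * x * z) /
        (1 - q ^ n * x * z)) atTop (𝓝 0) := by
      have := ((h0.mul_const z).neg.mul
        ((((h0.mul_const q⁻¹).mul_const x).mul_const z).const_sub 1)).div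
        (((h0.mul_const x).mul_const z).const_sub 1) (by simp)
      simpa [Pi.div_def] using this
    rw [← norm_zero (E := ℂ)]
    refine key.norm.congr fun n => ?_
    rw [← norm_div]
    congr 1
    push_cast
    rw [hstep, zpow_sub₀ hq0, zpow_natCast, zpow_one, div_eq_mul_inv (q ^ n) q]
  · refine summable_of_ratio_test_tendsto_lt_one (l := 0) one_pos (.of_forall fun n => hne _) ?_
    have key : Tendsto (fun n : ℕ => -(q ^ n * q * z⁻¹) * (q * (q ^ n * q - x * z)) /
        (q ^ n * q ^ 2 - x * z)) atTop (𝓝 0) := by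
      have := ((((h0.mul_const q).mul_const z⁻¹).neg.mul
        (((h0.mul_const q).sub_const (x * z)).const_mul q))).div
        ((h0.mul_const (q ^ 2)).sub_const (x * z)) (by simp [hx, hz])
      simpa [Pi.div_def] using this
    rw [← norm_zero (E := ℂ)]
    refine key.norm.congr fun n => ?_
    rw [← norm_div]
    congr 1
    have hs := hstep (-((n + 1 : ℕ) : ℤ))
    rw [show -((n + 1 : ℕ) : ℤ) + 1 = -(n : ℤ) by push_cast; ring] at hs
    rw [← inv_div (appellLerchTerm x q z (-(n : ℤ))), hs, inv_div]
    have c1 := h (-((n + 1 : ℕ) : ℤ))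
    have c2 := h (-((n + 1 : ℕ) : ℤ) - 1)
    have d1 : q ^ (-((n + 1 : ℕ) : ℤ)) = (q ^ n * q)⁻¹ := by
      rw [zpow_neg, zpow_natCast, pow_succ]
    have d2 : q ^ (-((n + 1 : ℕ) : ℤ) - 1) = (q ^ n * q ^ 2)⁻¹ := by
      rw [zpow_sub₀ hq0, d1, zpow_one]
      field_simp
    rw [d1] at c1
    rw [d2] at c2
    rw [d1, d2]
    have hqn := pow_ne_zero n hq0
    have f1 : 1 - (q ^ n * q)⁻¹ * x * z = (q ^ n * q - x * z) * (q ^ n * q)⁻¹ := by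
      field_simp
    have f2 : 1 - (q ^ n * q ^ 2)⁻¹ * x * z = (q ^ n * q ^ 2 - x * z) * (q ^ n * q ^ 2)⁻¹ := by
      field_simp
    rw [f2] at c2
    have c2' := left_ne_zero_of_mul c2
    rw [f1, f2]
    generalize q ^ n * q ^ 2 - x * z = B at *
    generalize q ^ n * q - x * z = A at *
    field_simp

end QSeries

namespace QSeries

open Filter Topology

/-! Write Q for the base `q ^ 2` and x = -aq. Both formulas follow from one identity,
`symPochSum_eq`, which evaluates the left side as -g plus an Appell–Lerch series L(Q²/x, x) divided
by (Q; Q)_∞, where L(w, y) = ∑ (-1)^r Q^{r(r-1)/2} w^r / (1 - Q^r y).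

The identity is a uniqueness statement for functional equations. Under x ↦ Qx the sum and g satisfy
first-order equations with the same multiplier -x³, because their terms telescope (`symPochSum_mul`,
`mockG_mul`); so does L(Q²/x, x), by shifting its index and splitting its denominator
(`lerchSeries_inv_mul`, which needs the Jacobi triple product). The inhomogeneous parts cancel, so
the difference of the two sides, multiplied by (x; Q)_∞ (Q/x; Q)_∞ to remove the poles, is a
holomorphic D on ℂ \ {0} with D(Qx) = x² D(x). For st = -1 the product D(x) j(sx) j(tx) changes sign
under x ↦ Qx. Its modulus is invariant, hence attains a maximum, hence the product is constant and
equal to its own negative, that is, zero (`eq_zero_of_antiperiodic`).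

Formula (B) is then a single shift of L. Formula (A) needs the passage from z = -q/a to z = -1
(`lerchSeries_change`). This is again a uniqueness statement: the defect has multiplier u⁻¹ and
vanishes at u = 1, so its quotient by j(u; Q) is holomorphic and antiperiodic
(`eq_zero_of_quasiperiodic`). The resulting theta quotient takes the stated shape by
`jTheta_product` and `jTheta_neg_one_mul`. -/

/-- The entire function `x ↦ ∏_{i ≥ 0} (1 - c_i x)` attached to a summable sequence `c`. -/
noncomputable def linProd (c : ℕ → ℂ) (x : ℂ) : ℂ :=
  ∏' i : ℕ, (1 - c i * x)

/-! ### Infinite products of linear factors -/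

section linProd

variable {c : ℕ → ℂ} {r : ℝ}

theorem summable_norm_neg_mul (hr0 : 0 ≤ r) (hr : r < 1) (hc : ∀ i, ‖c i‖ ≤ r ^ i) (x : ℂ) :
    Summable fun i : ℕ => ‖-(c i * x)‖ := by
  refine .of_nonneg_of_le (fun _ => norm_nonneg _) (fun i => ?_)
    ((summable_geometric_of_lt_one hr0 hr).mul_right ‖x‖)
  rw [norm_neg, norm_mul]
  exact mul_le_mul_of_nonneg_right (hc i) (norm_nonneg x)

theorem multipliable_linProd (hr0 : 0 ≤ r) (hr : r < 1) (hc : ∀ i, ‖c i‖ ≤ r ^ i) (x : ℂ) :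
    Multipliable fun i : ℕ => 1 - c i * x := by
  simpa [sub_eq_add_neg] using multipliable_one_add_of_summable (summable_norm_neg_mul hr0 hr hc x)

theorem norm_prod_one_sub_le (hr0 : 0 ≤ r) (hr : r < 1) (hc : ∀ i, ‖c i‖ ≤ r ^ i) (x : ℂ)
    (n : ℕ) : ‖∏ i ∈ Finset.range n, (1 - c i * x)‖ ≤ Real.exp (‖x‖ / (1 - r)) := by
  calc ‖∏ i ∈ Finset.range n, (1 - c i * x)‖
      ≤ ∏ i ∈ Finset.range n, ‖1 - c i * x‖ := Finset.norm_prod_le _ _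
    _ ≤ ∏ i ∈ Finset.range n, Real.exp (r ^ i * ‖x‖) := by
        refine Finset.prod_le_prod (fun _ _ => norm_nonneg _) fun i _ => ?_
        calc ‖1 - c i * x‖ ≤ 1 + ‖c i‖ * ‖x‖ := by
              simpa using norm_sub_le (1 : ℂ) (c i * x)
          _ ≤ r ^ i * ‖x‖ + 1 := by
              have := mul_le_mul_of_nonneg_right (hc i) (norm_nonneg x)
              linarith
          _ ≤ _ := Real.add_one_le_exp _
    _ = Real.exp (∑ i ∈ Finset.range n, r ^ i * ‖x‖) := (Real.exp_sum _ _).symm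
    _ ≤ Real.exp (‖x‖ / (1 - r)) := by
        refine Real.exp_le_exp.2 ?_
        rw [← Finset.sum_mul, div_eq_inv_mul, ← tsum_geometric_of_lt_one hr0 hr]
        exact mul_le_mul_of_nonneg_right
          ((summable_geometric_of_lt_one hr0 hr).sum_le_tsum _ fun i _ => pow_nonneg hr0 i)
          (norm_nonneg x)

theorem norm_linProd_le (hr0 : 0 ≤ r) (hr : r < 1) (hc : ∀ i, ‖c i‖ ≤ r ^ i) (x : ℂ) :
    ‖linProd c x‖ ≤ Real.exp (‖x‖ / (1 - r)) :=
  le_of_tendsto (multipliable_linProd hr0 hr hc x).hasProd.tendsto_prod_nat.norm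
    (.of_forall fun n => norm_prod_one_sub_le hr0 hr hc x n)

theorem differentiable_linProd (hr0 : 0 ≤ r) (hr : r < 1) (hc : ∀ i, ‖c i‖ ≤ r ^ i) :
    Differentiable ℂ (linProd c) := by
  intro x
  have hu : Summable fun i : ℕ => r ^ i * (‖x‖ + 1) :=
    (summable_geometric_of_lt_one hr0 hr).mul_right _
  have h := hu.hasProdLocallyUniformlyOn_nat_one_add (f := fun i y => -(c i * y))
    (K := Metric.ball x 1) Metric.isOpen_ball (.of_forall fun n y hy => ?_)
    (fun n => by fun_prop)
  · have hd := h.differentiableOn (.of_forall fun s => by fun_prop) Metric.isOpen_ball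
    have := (hd x (Metric.mem_ball_self one_pos)).differentiableAt
      (Metric.isOpen_ball.mem_nhds (Metric.mem_ball_self one_pos))
    simp only [← sub_eq_add_neg] at this
    exact this
  · rw [norm_neg, norm_mul]
    refine mul_le_mul (hc n) ?_ (norm_nonneg y) (pow_nonneg hr0 n)
    have : ‖y‖ ≤ ‖x‖ + ‖y - x‖ := by simpa using norm_add_le x (y - x)
    rw [mem_ball_iff_norm] at hy
    linarith

theorem linProd_ne_zero (hr0 : 0 ≤ r) (hr : r < 1) (hc : ∀ i, ‖c i‖ ≤ r ^ i) {x : ℂ}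
    (hx : ∀ i, 1 - c i * x ≠ 0) : linProd c x ≠ 0 := by
  have := tprod_one_add_ne_zero_of_summable (f := fun i => -(c i * x))
    (fun i => by simpa [sub_eq_add_neg] using hx i) (summable_norm_neg_mul hr0 hr hc x)
  simpa [linProd, sub_eq_add_neg] using this

/-- Splitting off one factor of the product. -/
theorem linProd_eq_mul_update (hr0 : 0 ≤ r) (hr : r < 1) (hc : ∀ i, ‖c i‖ ≤ r ^ i) (n : ℕ)
    (x : ℂ) : linProd c x = (1 - c n * x) * linProd (Function.update c n 0) x := by
  have hc' : ∀ i, ‖Function.update c n 0 i‖ ≤ r ^ i := fun i => by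
    rcases eq_or_ne i n with rfl | h
    · simpa using pow_nonneg hr0 i
    · simpa [h] using hc i
  have h1 : Multipliable fun i => Function.update (fun _ => (1 : ℂ)) n (1 - c n * x) i :=
    multipliable_of_ne_finset_one (s := {n}) fun i hi => by
      simp [Function.update_of_ne (by simpa using hi : i ≠ n)]
  have h2 : ∏' i, Function.update (fun _ => (1 : ℂ)) n (1 - c n * x) i = 1 - c n * x := by
    rw [tprod_eq_prod (s := {n}) fun i hi => by
      simp [Function.update_of_ne (by simpa using hi : i ≠ n)]]
    simp
  rw [linProd, linProd, ← h2, ← h1.tprod_mul (multipliable_linProd hr0 hr hc' x)]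
  refine tprod_congr fun i => ?_
  rcases eq_or_ne i n with rfl | h <;> simp [*]

end linProd

/-! ### Shifted factorials -/

section qPochInf

variable {q : ℂ}

theorem norm_pow_le_pow_norm (q : ℂ) (i : ℕ) : ‖q ^ i‖ ≤ ‖q‖ ^ i := (norm_pow q i).le

theorem qPochInf_eq_linProd (x q : ℂ) : qPochInf x q = linProd (fun i => q ^ i) x := rfl

theorem norm_qPoch_le (hq : ‖q‖ < 1) (x : ℂ) (n : ℕ) :
    ‖qPoch x q n‖ ≤ Real.exp (‖x‖ / (1 - ‖q‖)) :=
  norm_prod_one_sub_le (norm_nonneg q) hq (norm_pow_le_pow_norm q) x n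

theorem norm_qPochInf_le (hq : ‖q‖ < 1) (x : ℂ) :
    ‖qPochInf x q‖ ≤ Real.exp (‖x‖ / (1 - ‖q‖)) :=
  norm_linProd_le (norm_nonneg q) hq (norm_pow_le_pow_norm q) x

theorem differentiable_qPochInf (hq : ‖q‖ < 1) : Differentiable ℂ fun x => qPochInf x q :=
  differentiable_linProd (norm_nonneg q) hq (norm_pow_le_pow_norm q)

theorem qPochInf_ne_zero (hq : ‖q‖ < 1) {x : ℂ} (hx : ∀ i : ℕ, 1 - q ^ i * x ≠ 0) :
    qPochInf x q ≠ 0 :=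
  linProd_ne_zero (norm_nonneg q) hq (norm_pow_le_pow_norm q) hx

theorem qPoch_zero (x q : ℂ) : qPoch x q 0 = 1 := by simp [qPoch]

theorem qPoch_succ (x q : ℂ) (n : ℕ) : qPoch x q (n + 1) = qPoch x q n * (1 - q ^ n * x) := by
  rw [qPoch, Finset.prod_range_succ, ← qPoch]

theorem qPoch_succ' (x q : ℂ) (n : ℕ) : qPoch x q (n + 1) = (1 - x) * qPoch (q * x) q n := by
  rw [qPoch, Finset.prod_range_succ', qPoch, mul_comm, pow_zero, one_mul]
  simp only [pow_succ, mul_assoc]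

theorem qPochInf_eq_qPoch_mul (hq : ‖q‖ < 1) (x : ℂ) (n : ℕ) :
    qPochInf x q = qPoch x q n * qPochInf (q ^ n * x) q := by
  have h : Multipliable fun i : ℕ => 1 - q ^ (i + n) * x :=
    (multipliable_qPochInf hq (q ^ n * x)).congr fun i => by rw [pow_add, mul_assoc]
  have e : qPochInf x q = qPoch x q n * ∏' i : ℕ, (1 - q ^ (i + n) * x) :=
    (h.prod_mul_tprod_nat_mul' (f := fun i : ℕ => 1 - q ^ i * x)).symm
  rw [e]
  simp only [qPochInf, pow_add, mul_assoc]

theorem qPochInf_step (hq : ‖q‖ < 1) (x : ℂ) : qPochInf x q = (1 - x) * qPochInf (q * x) q := by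
  simpa [qPoch] using qPochInf_eq_qPoch_mul hq x 1

theorem tendsto_qPoch (hq : ‖q‖ < 1) (x : ℂ) :
    Tendsto (qPoch x q) atTop (𝓝 (qPochInf x q)) :=
  (multipliable_qPochInf hq x).hasProd.tendsto_prod_nat

theorem qPochInf_self_ne_zero (hq : ‖q‖ < 1) : qPochInf q q ≠ 0 := by
  refine qPochInf_ne_zero hq fun i h => ?_
  have : ‖q ^ (i + 1)‖ < 1 := by
    rw [norm_pow]; exact pow_lt_one₀ (norm_nonneg q) hq (by omega)
  rw [pow_succ, ← sub_eq_zero.1 h, norm_one] at this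
  exact lt_irrefl _ this

theorem qPochInf_one (hq : ‖q‖ < 1) : qPochInf 1 q = 0 := by
  rw [qPochInf_step hq, sub_self, zero_mul]

theorem qPochInf_mul_neg (hq : ‖q‖ < 1) (x : ℂ) :
    qPochInf x q * qPochInf (-x) q = qPochInf (x ^ 2) (q ^ 2) := by
  rw [qPochInf, qPochInf, ← (multipliable_qPochInf hq x).tprod_mul (multipliable_qPochInf hq (-x))]
  exact tprod_congr fun i => by ring

theorem norm_sq_lt_one (hq : ‖q‖ < 1) : ‖q ^ 2‖ < 1 := by
  rw [norm_pow]; exact pow_lt_one₀ (norm_nonneg q) hq two_ne_zero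

theorem qPochInf_even_mul_odd (hq : ‖q‖ < 1) (x : ℂ) :
    qPochInf x (q ^ 2) * qPochInf (q * x) (q ^ 2) = qPochInf x q := by
  have h2 := norm_sq_lt_one hq
  have e := tprod_even_mul_odd (f := fun i : ℕ => 1 - q ^ i * x)
    ((multipliable_qPochInf h2 x).congr fun i => by rw [pow_mul])
    ((multipliable_qPochInf h2 (q * x)).congr fun i => by
      rw [← pow_mul]; ring)
  rw [qPochInf, qPochInf, qPochInf, ← e]
  congr 1
  · exact tprod_congr fun i => by rw [pow_mul]
  · exact tprod_congr fun i => by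
      rw [← pow_mul]; ring

theorem bigJ_eq_qPochInf (m : ℕ) (q : ℂ) : bigJ m q = qPochInf (q ^ m) (q ^ m) :=
  tprod_congr fun i => by rw [← pow_mul, ← pow_add, mul_add, mul_one]

end qPochInf

/-! ### Elementary properties of the theta function -/

section jTheta

variable {q : ℂ}

theorem jTheta_mul (hq0 : q ≠ 0) (hq : ‖q‖ < 1) {x : ℂ} (hx : x ≠ 0) :
    jTheta (q * x) q = -x⁻¹ * jTheta x q := by
  have e : q / (q * x) = x⁻¹ := by field_simp
  rw [jTheta, jTheta, e, qPochInf_step hq x⁻¹, qPochInf_step hq x, ← div_eq_mul_inv q x]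
  field_simp
  ring

theorem jTheta_inv (hq : ‖q‖ < 1) {x : ℂ} (hx : x ≠ 0) :
    jTheta x⁻¹ q = -x⁻¹ * jTheta x q := by
  have e : q / x⁻¹ = q * x := by field_simp
  rw [jTheta, jTheta, e, qPochInf_step hq x⁻¹, qPochInf_step hq x, ← div_eq_mul_inv q x]
  field_simp
  ring

theorem jTheta_div (hq0 : q ≠ 0) {x : ℂ} (hx : x ≠ 0) : jTheta (q / x) q = jTheta x q := by
  have e : q / (q / x) = x := by field_simp
  rw [jTheta, jTheta, e, mul_comm (qPochInf x q)]

theorem jTheta_one (hq : ‖q‖ < 1) : jTheta 1 q = 0 := by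
  rw [jTheta, qPochInf_one hq, zero_mul, zero_mul]

theorem jTheta_ne_zero (hq : ‖q‖ < 1) {x : ℂ} (hx : x ≠ 0)
    (h : ∀ k : ℤ, x ≠ q ^ k) : jTheta x q ≠ 0 := by
  refine mul_ne_zero (mul_ne_zero (qPochInf_ne_zero hq fun i hi => h (-i) ?_)
    (qPochInf_ne_zero hq fun i hi => h (i + 1) ?_)) (qPochInf_self_ne_zero hq)
  · rw [zpow_neg, zpow_natCast]
    exact eq_inv_of_mul_eq_one_right (sub_eq_zero.1 hi).symm
  · have := (sub_eq_zero.1 hi).symm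
    rw [← mul_div_assoc, div_eq_one_iff_eq hx] at this
    rw [← this]
    exact_mod_cast (pow_succ q i).symm

theorem countable_zpow_mul (q c : ℂ) : {x : ℂ | ∃ k : ℤ, x = q ^ k * c}.Countable :=
  (Set.countable_range fun k : ℤ => q ^ k * c).mono (by
    rintro x ⟨k, hk⟩
    exact ⟨k, hk.symm⟩)

theorem differentiableAt_qPochInf_div (hq : ‖q‖ < 1) (c : ℂ) {x : ℂ} (hx : x ≠ 0) :
    DifferentiableAt ℂ (fun x => qPochInf (c / x) q) x :=
  DifferentiableAt.fun_comp' x (differentiable_qPochInf hq (c / x))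
    ((differentiableAt_const c).div differentiableAt_id hx)

theorem differentiableAt_jTheta (hq : ‖q‖ < 1) {x : ℂ} (hx : x ≠ 0) :
    DifferentiableAt ℂ (fun x => jTheta x q) x :=
  ((differentiable_qPochInf hq x).mul (differentiableAt_qPochInf_div hq q hx)).mul_const _

end jTheta

/-! ### Uniqueness for functional equations under multiplication by q -/

/-- The complement of a countable set is dense. Functional equations derived away from the poles of
a series thereby extend to every point by continuity. -/
theorem eqOn_of_eqOn_diff_countable {f g : ℂ → ℂ} {U S : Set ℂ} (hU : IsOpen U)
    (hS : S.Countable) (hf : ContinuousOn f U) (hg : ContinuousOn g U)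
    (h : ∀ x ∈ U, x ∉ S → f x = g x) : Set.EqOn f g U :=
  Set.EqOn.of_subset_closure (s := U ∩ Sᶜ) (fun x hx => h x hx.1 hx.2) hf hg
    Set.inter_subset_left ((hS.dense_compl ℂ).open_subset_closure_inter hU)

/-- The open annulus `|q| < |u| < |q|⁻¹`, which contains two fundamental domains for
multiplication by `q`. -/
def annulus (q : ℂ) : Set ℂ := {u | ‖q‖ < ‖u‖ ∧ ‖u‖ < ‖q‖⁻¹}

variable {q : ℂ}

theorem ne_zero_of_mem_annulus {u : ℂ} (hu : u ∈ annulus q) : u ≠ 0 :=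
  norm_pos_iff.1 ((norm_nonneg q).trans_lt hu.1)

theorem isOpen_annulus (q : ℂ) : IsOpen (annulus q) :=
  (isOpen_lt continuous_const continuous_norm).inter (isOpen_lt continuous_norm continuous_const)

/-- The annulus is the image under exp of a vertical strip, which is convex. -/
theorem isPreconnected_annulus (hq0 : q ≠ 0) : IsPreconnected (annulus q) := by
  have hpos : 0 < ‖q‖ := norm_pos_iff.2 hq0
  have e : annulus q = Complex.exp '' (Complex.reLm ⁻¹' Set.Ioo (Real.log ‖q‖) (-Real.log ‖q‖)) := by
    ext u
    constructor
    · intro hu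
      have hu0 := ne_zero_of_mem_annulus hu
      refine ⟨Complex.log u, ⟨?_, ?_⟩, Complex.exp_log hu0⟩
      · change Real.log ‖q‖ < (Complex.log u).re
        rw [Complex.log_re]
        exact Real.log_lt_log hpos hu.1
      · change (Complex.log u).re < _
        rw [Complex.log_re, ← Real.log_inv]
        exact Real.log_lt_log (norm_pos_iff.2 hu0) hu.2
    · rintro ⟨w, ⟨h1, h2⟩, rfl⟩
      change Real.log ‖q‖ < w.re at h1
      change w.re < _ at h2
      refine ⟨?_, ?_⟩
      · rw [Complex.norm_exp]
        exact (Real.log_lt_iff_lt_exp hpos).1 h1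
      · rw [Complex.norm_exp]
        rw [← Real.log_inv] at h2
        exact (Real.lt_log_iff_exp_lt (inv_pos.2 hpos)).1 h2
  rw [e]
  exact (((convex_Ioo _ _).linear_preimage Complex.reLm).isPreconnected).image _
    Complex.continuous_exp.continuousOn

/-- By the maximum principle, a function on the annulus that is antiperiodic under multiplication
by `q` vanishes. -/
theorem eq_zero_of_antiperiodic_annulus (hq0 : q ≠ 0) (hq : ‖q‖ < 1) {F : ℂ → ℂ}
    (hF : DifferentiableOn ℂ F (annulus q))
    (h : ∀ u, 1 < ‖u‖ → ‖u‖ < ‖q‖⁻¹ → F (q * u) = -F u) {u : ℂ} (hu : u ∈ annulus q) :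
    F u = 0 := by
  have hpos : 0 < ‖q‖ := norm_pos_iff.2 hq0
  -- The closed annulus r ≤ |u| ≤ r⁻¹ with r² = |q| is a compact fundamental domain: its boundary
  -- circles are exchanged by multiplication by q. A maximum of |F| on it is therefore a maximum on
  -- the whole open annulus.
  set r := √‖q‖ with hr
  have hr0 : 0 < r := Real.sqrt_pos.2 hpos
  have hrr : r * r = ‖q‖ := Real.mul_self_sqrt hpos.le
  have hr1 : r < 1 := by nlinarith
  have hqr : ‖q‖ < r := by nlinarith
  have hri : r⁻¹ < ‖q‖⁻¹ := (inv_lt_inv₀ hr0 hpos).2 hqr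
  have hri1 : 1 < r⁻¹ := (one_lt_inv₀ hr0).2 hr1
  have hqri : ‖q‖ * r⁻¹ = r := by rw [← hrr]; field_simp
  let K : Set ℂ := {u | r ≤ ‖u‖ ∧ ‖u‖ ≤ r⁻¹}
  have hKc : IsCompact K := by
    refine Metric.isCompact_of_isClosed_isBounded
      ((isClosed_le continuous_const continuous_norm).inter
        (isClosed_le continuous_norm continuous_const)) ?_
    exact (Metric.isBounded_closedBall (x := (0 : ℂ)) (r := r⁻¹)).subset fun u hu => by
      simpa using hu.2
  have hKV : K ⊆ annulus q := fun u hu => ⟨hqr.trans_le hu.1, hu.2.trans_lt hri⟩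
  obtain ⟨u₀, hu₀, hmax⟩ := hKc.exists_isMaxOn ⟨1, by simp [K, hr1.le, hri1.le]⟩
    (hF.continuousOn.mono hKV).norm
  have hmax' : IsMaxOn (norm ∘ F) (annulus q) u₀ := by
    intro v hv
    change ‖F v‖ ≤ ‖F u₀‖
    rcases lt_or_ge ‖v‖ r with h1 | h1
    · have hn : ‖v / q‖ = ‖v‖ / ‖q‖ := norm_div _ _
      have h2 : 1 < ‖v / q‖ := by rw [hn, one_lt_div hpos]; exact hv.1
      have h3 : ‖v / q‖ < r⁻¹ := by
        rw [hn, div_lt_iff₀ hpos, mul_comm, hqri]; exact h1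
      have h4 := h _ h2 (h3.trans hri)
      rw [mul_div_cancel₀ _ hq0] at h4
      rw [h4, norm_neg]
      exact hmax ⟨(hr1.trans h2).le, h3.le⟩
    · rcases lt_or_ge r⁻¹ ‖v‖ with h2 | h2
      · have hn : ‖q * v‖ = ‖q‖ * ‖v‖ := norm_mul _ _
        rw [← norm_neg, ← h v (hri1.trans h2) hv.2]
        refine hmax ⟨?_, ?_⟩
        · rw [hn, ← hqri]; gcongr
        · rw [hn]
          refine le_trans ?_ hri1.le
          rw [← mul_inv_cancel₀ hpos.ne']
          exact mul_le_mul_of_nonneg_left hv.2.le hpos.le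
      · exact hmax ⟨h1, h2⟩
  have hconst := Complex.eqOn_of_isPreconnected_of_isMaxOn_norm (isPreconnected_annulus hq0)
    (isOpen_annulus q) hF (hKV hu₀) hmax'
  -- The points r⁻¹ and q r⁻¹ both lie in the annulus, where F is constant, and antiperiodicity
  -- relates its values there.
  have hw : ‖((r⁻¹ : ℝ) : ℂ)‖ = r⁻¹ := by simp [hr0.le]
  have hwV : ((r⁻¹ : ℝ) : ℂ) ∈ annulus q := hKV ⟨by rw [hw]; linarith, hw.le⟩
  have hqw : ‖q * ((r⁻¹ : ℝ) : ℂ)‖ = r := by rw [norm_mul, hw, hqri]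
  have hqwV : q * ((r⁻¹ : ℝ) : ℂ) ∈ annulus q := hKV ⟨hqw.ge, by rw [hqw]; linarith⟩
  have h5 := h ((r⁻¹ : ℝ) : ℂ) (by rw [hw]; exact hri1) (by rw [hw]; exact hri)
  have h6 := hconst hwV
  have h7 := hconst hqwV
  have h8 := hconst hu
  simp only [Function.const_apply] at h6 h7 h8
  rw [h8]
  rw [h6, h7] at h5
  exact self_eq_neg.1 h5

/-- Every orbit of multiplication by q in ℂ \ {0} meets the annulus; the exponent comes from
locating |x| between consecutive powers of |q|⁻¹. -/
theorem forall_of_annulus (hq0 : q ≠ 0) (hq : ‖q‖ < 1) {P : ℂ → Prop}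
    (hP : ∀ x, x ≠ 0 → (P (q * x) ↔ P x)) (hV : ∀ x ∈ annulus q, P x) {x : ℂ} (hx : x ≠ 0) :
    P x := by
  have hpos : 0 < ‖q‖ := norm_pos_iff.2 hq0
  have key : ∀ k : ℕ, ∀ x, x ≠ 0 → (P (q ^ k * x) ↔ P x) := by
    intro k
    induction k with
    | zero => simp
    | succ k ih =>
      intro x hx
      rw [pow_succ, mul_assoc, ih _ (mul_ne_zero hq0 hx), hP x hx]
  obtain ⟨n, hn1, hn2⟩ := exists_mem_Ico_zpow (norm_pos_iff.2 hx) ((one_lt_inv₀ hpos).2 hq)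
  have hmem : q ^ n * x ∈ annulus q := by
    have hz : 0 < ‖q‖ ^ n := zpow_pos hpos n
    have h1 : 1 ≤ ‖q ^ n * x‖ := by
      rw [norm_mul, norm_zpow]
      rw [inv_zpow] at hn1
      calc (1 : ℝ) = ‖q‖ ^ n * (‖q‖ ^ n)⁻¹ := (mul_inv_cancel₀ hz.ne').symm
        _ ≤ _ := mul_le_mul_of_nonneg_left hn1 hz.le
    refine ⟨hq.trans_le h1, ?_⟩
    rw [norm_mul, norm_zpow]
    calc ‖q‖ ^ n * ‖x‖ < ‖q‖ ^ n * ‖q‖⁻¹ ^ (n + 1) := mul_lt_mul_of_pos_left hn2 hz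
      _ = ‖q‖⁻¹ := by
        rw [inv_zpow, zpow_add₀ hpos.ne', zpow_one]; field_simp
  have h1 := hV _ hmem
  obtain ⟨k, rfl | rfl⟩ := n.eq_nat_or_neg
  · rw [zpow_natCast] at h1
    exact (key k x hx).1 h1
  · have h2 := (key k _ (ne_zero_of_mem_annulus hmem)).2 h1
    rwa [zpow_neg, zpow_natCast, mul_inv_cancel_left₀ (pow_ne_zero k hq0)] at h2

theorem isOpen_compl_zero : IsOpen ({0}ᶜ : Set ℂ) := isOpen_compl_singleton

theorem eq_of_functional_equation (hq0 : q ≠ 0) {H c : ℂ → ℂ} {S : Set ℂ}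
    (hH : DifferentiableOn ℂ H {0}ᶜ) (hc : ContinuousOn c {0}ᶜ) (hS : S.Countable)
    (h : ∀ x, x ≠ 0 → x ∉ S → H (q * x) = c x * H x) {x : ℂ} (hx : x ≠ 0) :
    H (q * x) = c x * H x :=
  eqOn_of_eqOn_diff_countable (f := fun x => H (q * x)) (g := fun x => c x * H x)
    isOpen_compl_zero hS
    (hH.continuousOn.comp (by fun_prop) fun y hy => mul_ne_zero hq0 hy)
    (hc.mul hH.continuousOn) (fun y hy hyS => h y hy hyS) hx

/-- A holomorphic function on `ℂ \ {0}` that is antiperiodic under multiplication by `q`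
vanishes. -/
theorem eq_zero_of_antiperiodic (hq0 : q ≠ 0) (hq : ‖q‖ < 1) {H : ℂ → ℂ} {S : Set ℂ}
    (hH : DifferentiableOn ℂ H {0}ᶜ) (hS : S.Countable)
    (h : ∀ x, x ≠ 0 → x ∉ S → H (q * x) = -H x) {x : ℂ} (hx : x ≠ 0) : H x = 0 := by
  have h' : ∀ x, x ≠ 0 → H (q * x) = -H x := fun x hx => by
    simpa using eq_of_functional_equation (c := fun _ => -1) hq0 hH continuousOn_const hS
      (fun x hx hxS => by simpa using h x hx hxS) hx
  refine forall_of_annulus (P := fun x => H x = 0) hq0 hq (fun x hx => by simp [h' x hx])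
    (fun x hx => ?_) hx
  refine eq_zero_of_antiperiodic_annulus hq0 hq
    (hH.mono fun u hu => ne_zero_of_mem_annulus hu) (fun u hu _ => h' u ?_) hx
  exact norm_pos_iff.1 (one_pos.trans hu)

/-- A holomorphic function on `ℂ \ {0}` with `H (q x) = x⁻¹ H x` and `H 1 = 0` vanishes: its
quotient by `j(x; q)` is holomorphic and antiperiodic. -/
theorem eq_zero_of_quasiperiodic (hq0 : q ≠ 0) (hq : ‖q‖ < 1) {H : ℂ → ℂ} {S : Set ℂ}
    (hH : DifferentiableOn ℂ H {0}ᶜ) (hS : S.Countable)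
    (h : ∀ x, x ≠ 0 → x ∉ S → H (q * x) = x⁻¹ * H x) (h1 : H 1 = 0) {x : ℂ} (hx : x ≠ 0) :
    H x = 0 := by
  have hpos : 0 < ‖q‖ := norm_pos_iff.2 hq0
  have h' : ∀ x, x ≠ 0 → H (q * x) = x⁻¹ * H x := fun x hx =>
    eq_of_functional_equation (c := fun x => x⁻¹) hq0 hH continuousOn_inv₀ hS h hx
  -- This is j(u; q) / (1 - u). It has no zero in the annulus, since u = 1 is the only zero of the
  -- theta function there.
  let κ : ℂ → ℂ := fun u => qPochInf (q * u) q * qPochInf (q / u) q * qPochInf q q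
  have hκ : ∀ u ∈ annulus q, κ u ≠ 0 := by
    intro u hu
    have hlt : ∀ (i : ℕ) (w : ℂ), ‖w‖ < 1 → 1 - q ^ i * w ≠ 0 := by
      intro i w hw h0
      have h2 : ‖q ^ i * w‖ < 1 := by
        rw [norm_mul, norm_pow]
        exact mul_lt_one_of_nonneg_of_lt_one_right (pow_le_one₀ (norm_nonneg q) hq.le)
          (norm_nonneg w) hw
      rw [← sub_eq_zero.1 h0, norm_one] at h2
      exact lt_irrefl _ h2
    refine mul_ne_zero (mul_ne_zero (qPochInf_ne_zero hq fun i => hlt i _ ?_)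
      (qPochInf_ne_zero hq fun i => hlt i _ ?_)) (qPochInf_self_ne_zero hq)
    · rw [norm_mul, ← mul_inv_cancel₀ hpos.ne']
      exact mul_lt_mul_of_pos_left hu.2 hpos
    · rw [norm_div, div_lt_one (hpos.trans hu.1)]
      exact hu.1
  have hκd : DifferentiableOn ℂ κ (annulus q) := fun u hu =>
    (((((differentiable_qPochInf hq).comp (differentiable_id.const_mul q)) u).mul
      (differentiableAt_qPochInf_div hq q (ne_zero_of_mem_annulus hu))).mul_const
      _).differentiableWithinAt
  have hj : ∀ u, jTheta u q = (1 - u) * κ u := fun u => by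
    rw [jTheta, qPochInf_step hq u]; simp only [κ]; ring
  have h1V : (1 : ℂ) ∈ annulus q := ⟨by simpa using hq, by simpa using (one_lt_inv₀ hpos).2 hq⟩
  -- Up to sign, F is H / j. The divided slope of H at 1 removes the singularity at u = 1, where H
  -- vanishes.
  let F : ℂ → ℂ := fun u => dslope H 1 u / κ u
  have hF : DifferentiableOn ℂ F (annulus q) :=
    ((Complex.differentiableOn_dslope ((isOpen_annulus q).mem_nhds h1V)).2
      (hH.mono fun u hu => ne_zero_of_mem_annulus hu)).div hκd hκ
  have hFj : ∀ u ∈ annulus q, u ≠ 1 → F u * jTheta u q = -H u := by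
    intro u hu hu1
    have h2 : H u = (u - 1) * dslope H 1 u := by
      have := sub_smul_dslope H 1 u
      rw [h1, sub_zero, smul_eq_mul] at this
      exact this.symm
    have h3 : F u * κ u = dslope H 1 u := div_mul_cancel₀ _ (hκ u hu)
    rw [hj, h2, ← h3]
    ring
  have hF0 : ∀ u ∈ annulus q, F u = 0 := fun u hu => by
    refine eq_zero_of_antiperiodic_annulus hq0 hq hF (fun u hu1 hu2 => ?_) hu
    have hu0 : u ≠ 0 := norm_pos_iff.1 (one_pos.trans hu1)
    have hqn : ‖q * u‖ < 1 := by
      rw [norm_mul, ← mul_inv_cancel₀ hpos.ne']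
      exact mul_lt_mul_of_pos_left hu2 hpos
    have huV : u ∈ annulus q := ⟨hq.trans hu1, hu2⟩
    have hquV : q * u ∈ annulus q := by
      refine ⟨?_, hqn.trans ((one_lt_inv₀ hpos).2 hq)⟩
      rw [norm_mul]
      exact lt_mul_of_one_lt_right hpos hu1
    have hne : u ≠ 1 := by rintro rfl; simp at hu1
    have hqne : q * u ≠ 1 := fun h0 => by rw [h0] at hqn; simp at hqn
    have e1 := hFj u huV hne
    have e2 := hFj _ hquV hqne
    rw [h' u hu0, jTheta_mul hq0 hq hu0] at e2
    have hj0 : jTheta u q ≠ 0 := by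
      rw [hj]; exact mul_ne_zero (sub_ne_zero.2 hne.symm) (hκ u huV)
    have e3 : (F (q * u) + F u) * jTheta u q = 0 := by
      field_simp at e2
      linear_combination -e2 + e1
    exact eq_neg_of_add_eq_zero_left ((mul_eq_zero.1 e3).resolve_right hj0)
  refine forall_of_annulus (P := fun x => H x = 0) hq0 hq (fun x hx => by simp [h' x hx, hx])
    (fun u hu => ?_) hx
  rcases eq_or_ne u 1 with rfl | hu1
  · exact h1
  · have := hFj u hu hu1
    rw [hF0 u hu, zero_mul] at this
    exact neg_eq_zero.1 this.symm

/-! ### The theta series -/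

theorem summable_of_ratio_geometric {a : ℕ → ℝ} {ρ C : ℝ} (hρ0 : 0 ≤ ρ) (hρ : ρ < 1)
    (ha : ∀ n, 0 < a n) (h : ∀ n, a (n + 1) = ρ ^ n * C * a n) : Summable a := by
  refine summable_of_ratio_test_tendsto_lt_one (l := 0) one_pos (.of_forall fun n => (ha n).ne') ?_
  have key : Tendsto (fun n : ℕ => ρ ^ n * C) atTop (𝓝 0) := by
    simpa using (tendsto_pow_atTop_nhds_zero_of_lt_one hρ0 hρ).mul_const C
  rw [← norm_zero (E := ℝ)]
  refine key.norm.congr fun n => ?_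
  rw [← norm_div, h, mul_div_cancel_right₀ _ (ha n).ne']

theorem succ_mul_self_ediv_two (r : ℤ) : (r + 1) * (r + 1 - 1) / 2 = r * (r - 1) / 2 + r := by
  rw [show (r + 1) * (r + 1 - 1) = r * (r - 1) + r * 2 by ring]
  exact Int.add_mul_ediv_right _ _ two_ne_zero

theorem summable_zpow_triangular {ρ R : ℝ} (hρ0 : 0 < ρ) (hρ : ρ < 1) (hR : 0 < R) :
    Summable fun r : ℤ => ρ ^ (r * (r - 1) / 2) * R ^ r := by
  have hstep (r : ℤ) : ρ ^ ((r + 1) * (r + 1 - 1) / 2) * R ^ (r + 1) =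
      ρ ^ r * R * (ρ ^ (r * (r - 1) / 2) * R ^ r) := by
    rw [succ_mul_self_ediv_two, zpow_add₀ hρ0.ne', zpow_add_one₀ hR.ne']; ring
  have hpos (r : ℤ) : 0 < ρ ^ (r * (r - 1) / 2) * R ^ r :=
    mul_pos (zpow_pos hρ0 _) (zpow_pos hR _)
  refine Summable.of_nat_of_neg ?_ ?_
  · refine summable_of_ratio_geometric (C := R) hρ0.le hρ (fun n => hpos _) fun n => ?_
    have := hstep n
    rw [zpow_natCast ρ n] at this
    exact_mod_cast this
  · refine summable_of_ratio_geometric (C := ρ / R) hρ0.le hρ (fun n => hpos _) fun n => ?_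
    have h1 := hstep (-((n + 1 : ℕ) : ℤ))
    rw [show -((n + 1 : ℕ) : ℤ) + 1 = -(n : ℤ) by push_cast; ring] at h1
    rw [h1, zpow_neg ρ ((n + 1 : ℕ) : ℤ), zpow_natCast, pow_succ]
    have := pow_pos hρ0 n
    field_simp

/-- The coefficient `(-1)^r q^{r (r - 1) / 2}` of the theta series. -/
noncomputable def thetaCoeff (q : ℂ) (r : ℤ) : ℂ := (-1) ^ r * q ^ (r * (r - 1) / 2)

theorem thetaCoeff_zero (q : ℂ) : thetaCoeff q 0 = 1 := by simp [thetaCoeff]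

theorem thetaCoeff_add_one (hq0 : q ≠ 0) (r : ℤ) :
    thetaCoeff q (r + 1) = -(q ^ r * thetaCoeff q r) := by
  rw [thetaCoeff, thetaCoeff, succ_mul_self_ediv_two, zpow_add₀ hq0,
    zpow_add_one₀ (by norm_num : (-1 : ℂ) ≠ 0)]
  ring

theorem norm_thetaCoeff (q : ℂ) (r : ℤ) : ‖thetaCoeff q r‖ = ‖q‖ ^ (r * (r - 1) / 2) := by
  rw [thetaCoeff, norm_mul, norm_zpow, norm_zpow]; simp

theorem summable_norm_thetaCoeff_mul_zpow (hq0 : q ≠ 0) (hq : ‖q‖ < 1) {R : ℝ} (hR : 0 < R) :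
    Summable fun r : ℤ => ‖thetaCoeff q r‖ * R ^ r := by
  simpa only [norm_thetaCoeff] using summable_zpow_triangular (norm_pos_iff.2 hq0) hq hR

theorem summable_norm_thetaCoeff_bound (hq0 : q ≠ 0) (hq : ‖q‖ < 1) {R : ℝ} (hR : 0 < R) :
    Summable fun r : ℤ => ‖thetaCoeff q r‖ * (R ^ r + R⁻¹ ^ r) := by
  simpa only [mul_add] using (summable_norm_thetaCoeff_mul_zpow hq0 hq hR).add
    (summable_norm_thetaCoeff_mul_zpow hq0 hq (inv_pos.2 hR))

/-- A bound uniform over R⁻¹ ≤ t ≤ R and valid for exponents of either sign; it dominates bilateral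
series locally. -/
theorem zpow_le_zpow_add_inv_zpow {t R : ℝ} (ht : 0 < t) (h1 : t ≤ R) (h2 : t⁻¹ ≤ R) (r : ℤ) :
    t ^ r ≤ R ^ r + R⁻¹ ^ r := by
  have hR := ht.trans_le h1
  obtain ⟨n, rfl | rfl⟩ := r.eq_nat_or_neg
  · have := zpow_pos (inv_pos.2 hR) n
    have h3 : t ^ (n : ℤ) ≤ R ^ (n : ℤ) := by
      rw [zpow_natCast, zpow_natCast]; exact pow_le_pow_left₀ ht.le h1 n
    linarith
  · have := zpow_pos hR (-(n : ℤ))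
    have h3 : t ^ (-(n : ℤ)) ≤ R⁻¹ ^ (-(n : ℤ)) := by
      rw [zpow_neg, zpow_neg, inv_zpow, inv_inv, ← inv_zpow, zpow_natCast, zpow_natCast]
      exact pow_le_pow_left₀ (inv_pos.2 ht).le h2 n
    linarith

/-- The theta series `∑_{r ∈ ℤ} (-1)^r q^{r (r - 1) / 2} x^r`. -/
noncomputable def thetaSeries (x q : ℂ) : ℂ := ∑' r : ℤ, thetaCoeff q r * x ^ r

theorem summable_thetaCoeff_mul_of_bounded (hq0 : q ≠ 0) (hq : ‖q‖ < 1) {x : ℂ} (hx : x ≠ 0)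
    {d : ℤ → ℂ} {M : ℝ} (hd : ∀ m, ‖d m‖ ≤ M) :
    Summable fun r : ℤ => thetaCoeff q r * x ^ r * d r := by
  refine .of_norm_bounded
    ((summable_norm_thetaCoeff_mul_zpow hq0 hq (norm_pos_iff.2 hx)).mul_right M) fun r => ?_
  rw [norm_mul, norm_mul, norm_zpow]
  exact mul_le_mul_of_nonneg_left (hd r) (by positivity)

theorem summable_thetaCoeff_mul_zpow (hq0 : q ≠ 0) (hq : ‖q‖ < 1) {x : ℂ} (hx : x ≠ 0) :
    Summable fun r : ℤ => thetaCoeff q r * x ^ r := by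
  simpa using summable_thetaCoeff_mul_of_bounded hq0 hq hx (d := fun _ => 1) (M := 1) (by simp)

/-! ### The Jacobi triple product -/

section JacobiTripleProduct

/-- `1 / (q; q)_m`, extended by zero to negative `m`. -/
noncomputable def invQFactorial (q : ℂ) (m : ℤ) : ℂ :=
  if 0 ≤ m then (qPoch q q m.toNat)⁻¹ else 0

theorem one_sub_pow_succ_ne_zero (hq : ‖q‖ < 1) (n : ℕ) : 1 - q ^ n * q ≠ 0 := by
  intro h
  have : ‖q ^ (n + 1)‖ < 1 := by
    rw [norm_pow]; exact pow_lt_one₀ (norm_nonneg q) hq (by omega)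
  rw [pow_succ, ← sub_eq_zero.1 h, norm_one] at this
  exact lt_irrefl _ this

theorem qPoch_self_ne_zero (hq : ‖q‖ < 1) (n : ℕ) : qPoch q q n ≠ 0 :=
  Finset.prod_ne_zero_iff.2 fun i _ => one_sub_pow_succ_ne_zero hq i

/-- Extension by zero makes the recursion hold for every integer: at m = 0 the factor 1 - q^0
vanishes. Hence the truncated theta series below can be shifted without boundary terms. -/
theorem invQFactorial_sub_one (hq : ‖q‖ < 1) (m : ℤ) :
    invQFactorial q (m - 1) = (1 - q ^ m) * invQFactorial q m := by
  obtain ⟨n, rfl | rfl⟩ := m.eq_nat_or_neg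
  · cases n with
    | zero => simp [invQFactorial]
    | succ n =>
      have h1 := qPoch_self_ne_zero hq n
      have h2 := one_sub_pow_succ_ne_zero hq n
      rw [invQFactorial, invQFactorial, if_pos (by push_cast; omega), if_pos (by positivity),
        show (((n + 1 : ℕ) : ℤ) - 1).toNat = n by omega, Int.toNat_natCast, qPoch_succ,
        zpow_natCast, pow_succ]
      field_simp
  · cases n with
    | zero => simp [invQFactorial]
    | succ n =>
      rw [invQFactorial, invQFactorial, if_neg (by push_cast; omega), if_neg (by push_cast; omega),
        mul_zero]

theorem tendsto_inv_qPoch_self (hq : ‖q‖ < 1) :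
    Tendsto (fun n => (qPoch q q n)⁻¹) atTop (𝓝 (qPochInf q q)⁻¹) :=
  (tendsto_qPoch hq q).inv₀ (qPochInf_self_ne_zero hq)

theorem exists_norm_invQFactorial_le (hq : ‖q‖ < 1) : ∃ M, ∀ m, ‖invQFactorial q m‖ ≤ M := by
  obtain ⟨M, hM⟩ := (tendsto_inv_qPoch_self hq).norm.bddAbove_range
  refine ⟨M, fun m => ?_⟩
  have h (n : ℕ) : ‖(qPoch q q n)⁻¹‖ ≤ M := hM ⟨n, rfl⟩
  rw [invQFactorial]
  split_ifs
  · exact h _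
  · rw [norm_zero]; exact (norm_nonneg _).trans (h 0)

theorem tendsto_invQFactorial_add (hq : ‖q‖ < 1) (k : ℤ) :
    Tendsto (fun N : ℕ => invQFactorial q (N + k)) atTop (𝓝 (qPochInf q q)⁻¹) := by
  have h : Tendsto (fun N : ℕ => ((N : ℤ) + k).toNat) atTop atTop :=
    tendsto_atTop_mono (fun N => by omega : ∀ N : ℕ, N - k.natAbs ≤ ((N : ℤ) + k).toNat)
      (tendsto_sub_atTop_nat _)
  refine ((tendsto_inv_qPoch_self hq).comp h).congr' ?_
  filter_upwards [eventually_ge_atTop k.natAbs] with N hN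
  rw [Function.comp_apply, invQFactorial, if_pos (by omega)]

/-- The theta series truncated by the weights `1 / (q; q)_{N + k}`. -/
noncomputable def truncTheta (q : ℂ) (N : ℤ) (x : ℂ) : ℂ :=
  ∑' k : ℤ, thetaCoeff q k * x ^ k * invQFactorial q (N + k)

theorem summable_truncTheta (hq0 : q ≠ 0) (hq : ‖q‖ < 1) (N : ℤ) {x : ℂ} (hx : x ≠ 0) :
    Summable fun k : ℤ => thetaCoeff q k * x ^ k * invQFactorial q (N + k) := by
  obtain ⟨M, hM⟩ := exists_norm_invQFactorial_le hq
  exact summable_thetaCoeff_mul_of_bounded hq0 hq hx (fun m => hM (N + m))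

theorem truncTheta_mul (hq0 : q ≠ 0) (N : ℤ) {x : ℂ} (hx : x ≠ 0) :
    truncTheta q N (q * x) = -x⁻¹ * truncTheta q (N - 1) x := by
  rw [truncTheta, truncTheta, ← (Equiv.addRight (1 : ℤ)).tsum_eq
    fun k => thetaCoeff q k * x ^ k * invQFactorial q (N - 1 + k), ← tsum_mul_left]
  refine tsum_congr fun k => ?_
  simp only [Equiv.coe_addRight]
  rw [thetaCoeff_add_one hq0, mul_zpow, zpow_add_one₀ hx,
    show N - 1 + (k + 1) = N + k by ring]
  field_simp

/-- The recursion for the weights expresses level N - 1 through level N at x and at qx; the latter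
is again of level N - 1 at x by `truncTheta_mul`. -/
theorem truncTheta_step (hq0 : q ≠ 0) (hq : ‖q‖ < 1) (N : ℤ) {x : ℂ} (hx : x ≠ 0) :
    truncTheta q N x = (1 - q ^ N * x⁻¹) * truncTheta q (N - 1) x := by
  have h1 : truncTheta q (N - 1) x = truncTheta q N x - q ^ N * truncTheta q N (q * x) := by
    rw [truncTheta, truncTheta, truncTheta, ← tsum_mul_left,
      ← (summable_truncTheta hq0 hq N hx).tsum_sub
        ((summable_truncTheta hq0 hq N (mul_ne_zero hq0 hx)).mul_left _)]
    refine tsum_congr fun k => ?_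
    rw [show N - 1 + k = N + k - 1 by ring, invQFactorial_sub_one hq, mul_zpow, zpow_add₀ hq0]
    ring
  rw [truncTheta_mul hq0 N hx] at h1
  linear_combination -h1

theorem truncTheta_eq_qPoch_mul (hq0 : q ≠ 0) (hq : ‖q‖ < 1) {x : ℂ} (hx : x ≠ 0) (N : ℕ) :
    truncTheta q N x = qPoch (q / x) q N * truncTheta q 0 x := by
  induction N with
  | zero => simp [qPoch]
  | succ N ih =>
    rw [truncTheta_step hq0 hq _ hx, qPoch_succ,
      show ((N + 1 : ℕ) : ℤ) - 1 = N by push_cast; ring, ih, zpow_natCast, pow_succ]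
    ring

theorem truncTheta_zero_eq_qPoch_mul (hq0 : q ≠ 0) (hq : ‖q‖ < 1) {x : ℂ} (hx : x ≠ 0) (N : ℕ) :
    truncTheta q 0 x = qPoch x q N * truncTheta q 0 (q ^ N * x) := by
  induction N with
  | zero => simp [qPoch]
  | succ N ih =>
    have hy : q ^ N * x ≠ 0 := mul_ne_zero (pow_ne_zero _ hq0) hx
    rw [ih, qPoch_succ, pow_succ', mul_assoc q, truncTheta_mul hq0 _ hy,
      truncTheta_step hq0 hq 0 hy, zpow_zero]
    field_simp
    ring

/-- At level 0 only the terms with k ≥ 0 are nonzero, so the series tends to its constant term 1 as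
its argument q^N x tends to 0. Iterating T₀(x) = (1 - x) T₀(qx) gives the product. -/
theorem truncTheta_zero_eq_qPochInf (hq0 : q ≠ 0) (hq : ‖q‖ < 1) {x : ℂ} (hx : x ≠ 0) :
    truncTheta q 0 x = qPochInf x q := by
  obtain ⟨M, hM⟩ := exists_norm_invQFactorial_le hq
  have hpow : Tendsto (fun N : ℕ => q ^ N) atTop (𝓝 0) :=
    tendsto_pow_atTop_nhds_zero_of_norm_lt_one hq
  have hlim : Tendsto (fun N : ℕ => truncTheta q 0 (q ^ N * x)) atTop (𝓝 1) := by
    have e : (1 : ℂ) = ∑' k : ℤ, if k = 0 then 1 else 0 := by simp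
    rw [e]
    refine tendsto_tsum_of_dominated_convergence
      ((summable_norm_thetaCoeff_mul_zpow hq0 hq (norm_pos_iff.2 hx)).mul_right M)
      (fun k => ?_) (.of_forall fun N k => ?_)
    · rw [zero_add]
      obtain ⟨n, rfl | rfl⟩ := k.eq_nat_or_neg
      · cases n with
        | zero => simp [thetaCoeff_zero, invQFactorial, qPoch]
        | succ n =>
          rw [if_neg (by positivity)]
          have h1 : Tendsto (fun N : ℕ => (q ^ N * x) ^ (n + 1)) atTop (𝓝 0) := by
            simpa using (hpow.mul_const x).pow (n + 1)
          simp only [zpow_natCast]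
          simpa only [mul_zero, zero_mul] using (h1.const_mul (thetaCoeff q ((n + 1 : ℕ) : ℤ))).mul_const
            (invQFactorial q ((n + 1 : ℕ) : ℤ))
      · cases n with
        | zero => simp [thetaCoeff_zero, invQFactorial, qPoch]
        | succ n =>
          rw [if_neg (by simp; omega)]
          simp [invQFactorial, show ¬ (0 : ℤ) ≤ -1 + -(n : ℤ) by omega]
    · rw [zero_add, norm_mul, norm_mul, norm_zpow]
      obtain ⟨n, rfl | rfl⟩ := k.eq_nat_or_neg
      · refine mul_le_mul (mul_le_mul_of_nonneg_left ?_ (norm_nonneg _)) (hM _) (norm_nonneg _)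
          (by positivity)
        rw [zpow_natCast, zpow_natCast]
        refine pow_le_pow_left₀ (norm_nonneg _) ?_ n
        rw [norm_mul, norm_pow]
        exact mul_le_of_le_one_left (norm_nonneg _) (pow_le_one₀ (norm_nonneg q) hq.le)
      · cases n with
        | zero => simpa using mul_le_mul_of_nonneg_left (hM 0) (norm_nonneg (thetaCoeff q 0))
        | succ n =>
          have h0 : invQFactorial q (-((n + 1 : ℕ) : ℤ)) = 0 := if_neg (by push_cast; omega)
          have : 0 ≤ M := (norm_nonneg _).trans (hM 0)
          rw [h0, norm_zero, mul_zero]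
          positivity
  have h2 := (tendsto_qPoch hq x).mul hlim
  rw [mul_one] at h2
  refine tendsto_nhds_unique (tendsto_const_nhds.congr fun N => ?_) h2
  exact truncTheta_zero_eq_qPoch_mul hq0 hq hx N

/-- The Jacobi triple product identity. -/
theorem thetaSeries_eq_jTheta (hq0 : q ≠ 0) (hq : ‖q‖ < 1) {x : ℂ} (hx : x ≠ 0) :
    thetaSeries x q = jTheta x q := by
  obtain ⟨M, hM⟩ := exists_norm_invQFactorial_le hq
  -- As N grows all weights tend to 1 / (q; q)_∞, while the recursion in N builds the factor (q/x;
  -- q)_∞.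
  have h1 : Tendsto (fun N : ℕ => truncTheta q N x) atTop
      (𝓝 (∑' k : ℤ, thetaCoeff q k * x ^ k * (qPochInf q q)⁻¹)) := by
    refine tendsto_tsum_of_dominated_convergence
      ((summable_norm_thetaCoeff_mul_zpow hq0 hq (norm_pos_iff.2 hx)).mul_right M)
      (fun k => (tendsto_invQFactorial_add hq k).const_mul _) (.of_forall fun N k => ?_)
    rw [norm_mul, norm_mul, norm_zpow]
    exact mul_le_mul_of_nonneg_left (hM _) (by positivity)
  have h2 : Tendsto (fun N : ℕ => truncTheta q N x) atTop
      (𝓝 (qPochInf (q / x) q * qPochInf x q)) := by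
    refine ((tendsto_qPoch hq (q / x)).mul_const _).congr fun N => ?_
    rw [truncTheta_eq_qPoch_mul hq0 hq hx N, truncTheta_zero_eq_qPochInf hq0 hq hx]
  have h3 := tendsto_nhds_unique h1 h2
  rw [tsum_mul_right, mul_inv_eq_iff_eq_mul₀ (qPochInf_self_ne_zero hq)] at h3
  rw [thetaSeries, h3, jTheta]
  ring

end JacobiTripleProduct

/-! ### Appell–Lerch series and their shifts -/

/-- The Appell--Lerch series `∑_{r ∈ ℤ} (-1)^r q^{r (r - 1) / 2} w^r / (1 - q^r y)`. -/
noncomputable def lerchSeries (q w y : ℂ) : ℂ := ∑' r : ℤ, thetaCoeff q r * w ^ r / (1 - q ^ r * y)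

theorem appellLerchTerm_eq (hq0 : q ≠ 0) (x z : ℂ) (r : ℤ) :
    appellLerchTerm x q z r = thetaCoeff q r * z ^ r / (1 - q ^ r * (x * z / q)) := by
  rw [appellLerchTerm, thetaCoeff, zpow_sub_one₀ hq0]
  congr 2
  ring

theorem appellLerch_eq (hq0 : q ≠ 0) (x z : ℂ) :
    appellLerch x q z = 1 / jTheta z q * lerchSeries q z (x * z / q) := by
  rw [appellLerch, lerchSeries]
  simp only [appellLerchTerm_eq hq0]

theorem summable_lerchSeries (hq0 : q ≠ 0) (hq : ‖q‖ < 1) {w y : ℂ} (hw : w ≠ 0) (hy0 : y ≠ 0)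
    (hy : ∀ r : ℤ, 1 - q ^ r * y ≠ 0) :
    Summable fun r : ℤ => thetaCoeff q r * w ^ r / (1 - q ^ r * y) := by
  have e : q * y / w * w / q = y := by field_simp
  refine (summable_appellLerchTerm (x := q * y / w) (z := w) hq0 hq (by positivity) hw
    fun r => ?_).congr fun r => ?_
  · have := hy (r + 1)
    rw [zpow_add_one₀ hq0] at this
    convert this using 2
    field_simp
  · rw [appellLerchTerm_eq hq0, e]

/-- Reindex by r ↦ r + 1, which turns q^r · qy into q^{r+1} y. -/
theorem lerchSeries_mul (hq0 : q ≠ 0) {w : ℂ} (hw : w ≠ 0) (y : ℂ) :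
    lerchSeries q w (q * y) = -(q / w) * lerchSeries q (w / q) y := by
  rw [lerchSeries, lerchSeries, ← (Equiv.addRight (1 : ℤ)).tsum_eq
    fun r => thetaCoeff q r * (w / q) ^ r / (1 - q ^ r * y), ← tsum_mul_left]
  refine tsum_congr fun r => ?_
  simp only [Equiv.coe_addRight]
  rw [thetaCoeff_add_one hq0, div_zpow, zpow_add_one₀ hq0, zpow_add_one₀ hw, ← mul_assoc (q ^ r)]
  have := zpow_ne_zero r hq0
  field_simp

/-- Termwise 1 / (1 - q^r y) = 1 + q^r y / (1 - q^r y); the first part sums to a theta function by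
the triple product. -/
theorem lerchSeries_eq_add (hq0 : q ≠ 0) (hq : ‖q‖ < 1) {w y : ℂ} (hw : w ≠ 0) (hy0 : y ≠ 0)
    (hy : ∀ r : ℤ, 1 - q ^ r * y ≠ 0) :
    lerchSeries q w y = jTheta w q + y * lerchSeries q (q * w) y := by
  rw [← thetaSeries_eq_jTheta hq0 hq hw, lerchSeries, lerchSeries, thetaSeries, ← tsum_mul_left,
    ← (summable_thetaCoeff_mul_zpow hq0 hq hw).tsum_add
      ((summable_lerchSeries hq0 hq (mul_ne_zero hq0 hw) hy0 hy).mul_left y)]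
  refine tsum_congr fun r => ?_
  rw [mul_zpow]
  have := hy r
  field_simp
  ring

/-! ### Removing the poles of the Appell–Lerch series -/

/-- The function `(y; q)_∞ (q/y; q)_∞ / (1 - q^r y)`, extended holomorphically to the zero of its
denominator. -/
noncomputable def omitFactor (q : ℂ) (r : ℤ) (y : ℂ) : ℂ :=
  match r with
  | .ofNat n => linProd (Function.update (fun i => q ^ i) n 0) y * qPochInf (q / y) q
  | .negSucc n => qPochInf y q * linProd (Function.update (fun i => q ^ i) n 0) (q / y) *
      (-(q ^ (n + 1) / y))

theorem norm_update_pow_le (q : ℂ) (n i : ℕ) :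
    ‖Function.update (fun i => q ^ i) n 0 i‖ ≤ ‖q‖ ^ i := by
  rcases eq_or_ne i n with rfl | h
  · simp
  · simp [h]

theorem one_sub_mul_omitFactor (hq0 : q ≠ 0) (hq : ‖q‖ < 1) (r : ℤ) {y : ℂ} (hy : y ≠ 0) :
    (1 - q ^ r * y) * omitFactor q r y = qPochInf y q * qPochInf (q / y) q := by
  have h (n : ℕ) (x : ℂ) := linProd_eq_mul_update (norm_nonneg q) hq (norm_pow_le_pow_norm q) n x
  cases r with
  | ofNat n =>
    rw [omitFactor, Int.ofNat_eq_natCast, zpow_natCast, qPochInf_eq_linProd y, h n y]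
    ring
  | negSucc n =>
    rw [omitFactor, zpow_negSucc, qPochInf_eq_linProd (q / y), h n (q / y)]
    have := pow_ne_zero (n + 1) hq0
    field_simp
    ring

theorem norm_omitFactor_le (hq : ‖q‖ < 1) (r : ℤ) {y : ℂ} {R : ℝ} (hR : 1 ≤ R) (h1 : ‖y‖ ≤ R)
    (h2 : ‖y⁻¹‖ ≤ R) : ‖omitFactor q r y‖ ≤ Real.exp (R / (1 - ‖q‖)) ^ 2 * R := by
  have hR0 : 0 ≤ R := zero_le_one.trans hR
  have h1q : 0 < 1 - ‖q‖ := sub_pos.2 hq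
  have h3 : ‖q / y‖ ≤ R := by
    rw [div_eq_mul_inv, norm_mul]
    exact (mul_le_of_le_one_left (norm_nonneg _) hq.le).trans h2
  have hexp {x : ℂ} (hx : ‖x‖ ≤ R) : Real.exp (‖x‖ / (1 - ‖q‖)) ≤ Real.exp (R / (1 - ‖q‖)) :=
    Real.exp_le_exp.2 (div_le_div_of_nonneg_right hx h1q.le)
  have ha {x : ℂ} (hx : ‖x‖ ≤ R) : ‖qPochInf x q‖ ≤ Real.exp (R / (1 - ‖q‖)) :=
    (norm_qPochInf_le hq x).trans (hexp hx)
  have hb (n : ℕ) {x : ℂ} (hx : ‖x‖ ≤ R) :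
      ‖linProd (Function.update (fun i => q ^ i) n 0) x‖ ≤ Real.exp (R / (1 - ‖q‖)) :=
    (norm_linProd_le (norm_nonneg q) hq (norm_update_pow_le q n) x).trans (hexp hx)
  have hE := Real.exp_pos (R / (1 - ‖q‖))
  cases r with
  | ofNat n =>
    rw [omitFactor, norm_mul, sq]
    refine (mul_le_mul (hb n h1) (ha h3) (norm_nonneg _) hE.le).trans ?_
    exact le_mul_of_one_le_right (mul_nonneg hE.le hE.le) hR
  | negSucc n =>
    rw [omitFactor, norm_mul, norm_mul, norm_neg, sq]
    refine mul_le_mul (mul_le_mul (ha h1) (hb n h3) (norm_nonneg _) hE.le) ?_ (norm_nonneg _)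
      (mul_nonneg hE.le hE.le)
    rw [div_eq_mul_inv, norm_mul, norm_pow]
    exact (mul_le_of_le_one_left (norm_nonneg _) (pow_le_one₀ (norm_nonneg q) hq.le)).trans h2

theorem differentiableAt_omitFactor (hq : ‖q‖ < 1) (r : ℤ) {y : ℂ} (hy : y ≠ 0) :
    DifferentiableAt ℂ (omitFactor q r) y := by
  have hL (n : ℕ) := differentiable_linProd (norm_nonneg q) hq (norm_update_pow_le q n)
  have hd : DifferentiableAt ℂ (fun y => q / y) y :=
    (differentiableAt_const q).div differentiableAt_id hy
  cases r with
  | ofNat n => exact (hL n y).mul (differentiableAt_qPochInf_div hq q hy)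
  | negSucc n =>
    exact ((differentiable_qPochInf hq y).mul (DifferentiableAt.fun_comp' y (hL n (q / y)) hd)).mul
      ((differentiableAt_const _).div differentiableAt_id hy).neg

/-- The Appell--Lerch series multiplied by `(y; q)_∞ (q/y; q)_∞`, extended holomorphically to the
poles of the series. -/
noncomputable def lerchEntire (q w y : ℂ) : ℂ :=
  ∑' r : ℤ, thetaCoeff q r * w ^ r * omitFactor q r y

theorem lerchEntire_eq (hq0 : q ≠ 0) (hq : ‖q‖ < 1) (w : ℂ) {y : ℂ} (hy0 : y ≠ 0)
    (hy : ∀ r : ℤ, 1 - q ^ r * y ≠ 0) :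
    lerchEntire q w y = qPochInf y q * qPochInf (q / y) q * lerchSeries q w y := by
  rw [lerchEntire, lerchSeries, ← tsum_mul_left]
  refine tsum_congr fun r => ?_
  rw [← one_sub_mul_omitFactor hq0 hq r hy0]
  have := hy r
  field_simp

theorem jTheta_mul_lerchSeries (hq0 : q ≠ 0) (hq : ‖q‖ < 1) (w : ℂ) {y : ℂ} (hy0 : y ≠ 0)
    (hy : ∀ r : ℤ, 1 - q ^ r * y ≠ 0) :
    jTheta y q * lerchSeries q w y = qPochInf q q * lerchEntire q w y := by
  rw [lerchEntire_eq hq0 hq w hy0 hy, jTheta]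
  ring

/-- At y = 1 the product (y; q)_∞ (q/y; q)_∞ vanishes, so only the term r = 0, whose own denominator
vanishes, survives. This plays the role of a residue. -/
theorem lerchEntire_one (hq0 : q ≠ 0) (hq : ‖q‖ < 1) (w : ℂ) :
    lerchEntire q w 1 = qPochInf q q ^ 2 := by
  have h0 (r : ℤ) (hr : r ≠ 0) : omitFactor q r 1 = 0 := by
    have h := one_sub_mul_omitFactor hq0 hq r one_ne_zero
    rw [qPochInf_one hq, zero_mul] at h
    refine (mul_eq_zero.1 h).resolve_left fun h1 => ?_
    rw [mul_one, sub_eq_zero] at h1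
    have h2 : ‖q‖ ^ r = 1 := by rw [← norm_zpow, ← h1, norm_one]
    exact hr ((zpow_eq_one_iff_right₀ (norm_nonneg q) hq.ne).1 h2)
  have hone : omitFactor q 0 1 = qPochInf q q ^ 2 := by
    have hu : linProd (Function.update (fun i => q ^ i) 0 0) 1 = qPochInf q q := by
      rw [linProd, tprod_eq_zero_mul', qPochInf]
      · simp [pow_succ]
      · exact (multipliable_qPochInf hq q).congr fun i => by simp [pow_succ]
    change linProd (Function.update (fun i => q ^ i) 0 0) 1 * qPochInf (q / 1) q = _
    rw [hu, div_one, sq]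
  rw [lerchEntire, tsum_eq_single 0 fun r hr => by rw [h0 r hr, mul_zero], hone, thetaCoeff_zero]
  simp

/-- A series of holomorphic functions on an open set that is dominated near a point is
differentiable at this point. -/
theorem differentiableAt_tsum_of_dominated {ι : Type*} {F : ι → ℂ → ℂ} {u : ι → ℝ} {U : Set ℂ}
    (hU : IsOpen U) (hF : ∀ i, DifferentiableOn ℂ (F i) U) (hu : Summable u) {x₀ : ℂ}
    (hx₀ : x₀ ∈ U) (hb : ∀ᶠ x in 𝓝 x₀, ∀ i, ‖F i x‖ ≤ u i) :
    DifferentiableAt ℂ (fun x => ∑' i, F i x) x₀ := by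
  obtain ⟨V, hV, hVo, hxV⟩ := mem_nhds_iff.1 hb
  have h := Complex.differentiableOn_tsum_of_summable_norm (U := V ∩ U) hu
    (fun i => (hF i).mono Set.inter_subset_right) (hVo.inter hU) fun i w hw => hV hw.1 i
  exact (h x₀ ⟨hxV, hx₀⟩).differentiableAt ((hVo.inter hU).mem_nhds ⟨hxV, hx₀⟩)

theorem exists_norm_bound_nhds {f : ℂ → ℂ} {x₀ : ℂ} (hf : ContinuousAt f x₀) :
    ∃ R : ℝ, ∀ R' ≥ R, ∀ᶠ x in 𝓝 x₀, ‖f x‖ ≤ R' :=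
  ⟨‖f x₀‖ + 1, fun _ hR' => (hf.norm.eventually_lt_const (lt_add_one _)).mono
    fun _ hx => hx.le.trans hR'⟩

theorem exists_norm_and_norm_inv_bound_nhds {f : ℂ → ℂ} {x₀ : ℂ} (hf : ContinuousAt f x₀)
    (h0 : f x₀ ≠ 0) :
    ∃ R : ℝ, ∀ R' ≥ R, ∀ᶠ x in 𝓝 x₀, f x ≠ 0 ∧ ‖f x‖ ≤ R' ∧ ‖(f x)⁻¹‖ ≤ R' := by
  obtain ⟨R₁, h1⟩ := exists_norm_bound_nhds hf
  obtain ⟨R₂, h2⟩ := exists_norm_bound_nhds (hf.inv₀ h0)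
  refine ⟨max R₁ R₂, fun R' hR' => ?_⟩
  filter_upwards [hf.eventually_ne h0, h1 R' ((le_max_left _ _).trans hR'),
    h2 R' ((le_max_right _ _).trans hR')] with x a b c using ⟨a, b, c⟩

theorem differentiableOn_lerchEntire (hq0 : q ≠ 0) (hq : ‖q‖ < 1) {w y : ℂ → ℂ}
    (hw : DifferentiableOn ℂ w {0}ᶜ) (hw0 : ∀ x, x ≠ 0 → w x ≠ 0)
    (hy : DifferentiableOn ℂ y {0}ᶜ) (hy0 : ∀ x, x ≠ 0 → y x ≠ 0) :
    DifferentiableOn ℂ (fun x => lerchEntire q (w x) (y x)) {0}ᶜ := by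
  intro x₀ hx₀
  have hat {f : ℂ → ℂ} (hf : DifferentiableOn ℂ f {0}ᶜ) {x : ℂ} (hx : x ≠ 0) :
      DifferentiableAt ℂ f x := (hf x hx).differentiableAt (isOpen_compl_zero.mem_nhds hx)
  obtain ⟨R₁, h1⟩ := exists_norm_and_norm_inv_bound_nhds (hat hw hx₀).continuousAt (hw0 _ hx₀)
  obtain ⟨R₂, h2⟩ := exists_norm_and_norm_inv_bound_nhds (hat hy hx₀).continuousAt (hy0 _ hx₀)
  set R := max (max R₁ R₂) 1 with hR
  have hR1 : 1 ≤ R := le_max_right _ _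
  have hR0 : 0 < R := one_pos.trans_le hR1
  refine (differentiableAt_tsum_of_dominated isOpen_compl_zero (fun r x hx => ?_)
    ((summable_norm_thetaCoeff_bound hq0 hq hR0).mul_right
      (Real.exp (R / (1 - ‖q‖)) ^ 2 * R)) hx₀ ?_).differentiableWithinAt
  · refine DifferentiableAt.differentiableWithinAt ?_
    exact (((hat hw hx).zpow (.inl (hw0 x hx))).const_mul _).mul
      (DifferentiableAt.fun_comp' x (differentiableAt_omitFactor hq r (hy0 x hx)) (hat hy hx))
  · filter_upwards [h1 R ((le_max_left _ _).trans (le_max_left _ _)),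
      h2 R ((le_max_right _ _).trans (le_max_left _ _))] with x ⟨a1, a2, a3⟩ ⟨b1, b2, b3⟩ r
    rw [norm_mul, norm_mul, norm_zpow]
    refine mul_le_mul (mul_le_mul_of_nonneg_left ?_ (norm_nonneg _))
      (norm_omitFactor_le hq r hR1 b2 b3) (norm_nonneg _) (by positivity)
    exact zpow_le_zpow_add_inv_zpow (norm_pos_iff.2 a1) a2 (by rwa [norm_inv] at a3) r

/-! ### Points off the powers of q -/

section GenericPoints

theorem one_sub_zpow_mul_ne_zero {x : ℂ} (hx : ∀ k : ℤ, x ≠ q ^ k) (r : ℤ) :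
    1 - q ^ r * x ≠ 0 := by
  intro h
  refine hx (-r) ?_
  rw [zpow_neg]
  exact eq_inv_of_mul_eq_one_right (sub_eq_zero.1 h).symm

theorem one_sub_zpow_div_ne_zero {x : ℂ} (hx0 : x ≠ 0) (hx : ∀ k : ℤ, x ≠ q ^ k)
    (r : ℤ) : 1 - q ^ r / x ≠ 0 := by
  rw [one_sub_div hx0]
  exact div_ne_zero (sub_ne_zero.2 (hx r)) hx0

theorem mul_ne_zpow (hq0 : q ≠ 0) {x : ℂ} (hx : ∀ k : ℤ, x ≠ q ^ k) (k : ℤ) : q * x ≠ q ^ k := by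
  intro h
  refine hx (k - 1) ?_
  rw [zpow_sub_one₀ hq0, ← h]
  field_simp

end GenericPoints

/-! ### Functional equation of the left side -/

section SymPochSum

theorem summable_symPoch (hq : ‖q‖ < 1) (x y : ℂ) :
    Summable fun n : ℕ => q ^ n * (qPoch x q n * qPoch y q n) := by
  refine .of_norm_bounded ((summable_geometric_of_lt_one (norm_nonneg q) hq).mul_right
    (Real.exp (‖x‖ / (1 - ‖q‖)) * Real.exp (‖y‖ / (1 - ‖q‖)))) fun n => ?_
  rw [norm_mul, norm_mul, norm_pow]
  exact mul_le_mul_of_nonneg_left (mul_le_mul (norm_qPoch_le hq x n) (norm_qPoch_le hq y n)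
    (norm_nonneg _) (Real.exp_pos _).le) (by positivity)

/-- The series `∑_{n ≥ 0} q^n (x; q)_n (q/x; q)_n`. -/
noncomputable def symPochSum (x q : ℂ) : ℂ :=
  ∑' n : ℕ, q ^ n * (qPoch x q n * qPoch (q / x) q n)

theorem qPoch_mul_shift (x : ℂ) (n : ℕ) :
    (1 - x) * qPoch (q * x) q n = (1 - q ^ n * x) * qPoch x q n := by
  rw [← qPoch_succ', qPoch_succ, mul_comm]

theorem qPoch_inv_shift (x : ℂ) (n : ℕ) :
    (1 - q ^ n / x) * qPoch x⁻¹ q n = (1 - x⁻¹) * qPoch (q / x) q n := by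
  have := qPoch_mul_shift (q := q) x⁻¹ n
  rw [← div_eq_mul_inv, ← div_eq_mul_inv] at this
  exact this.symm

theorem qPoch_mul_qPoch_inv {x : ℂ} (hx0 : x ≠ 0) (hx : ∀ k : ℤ, x ≠ q ^ k)
    (n : ℕ) : (x - q ^ n) * (qPoch (q * x) q n * qPoch x⁻¹ q n) =
      -((1 - q ^ n * x) * (qPoch x q n * qPoch (q / x) q n)) := by
  have h1 : 1 - x ≠ 0 := by simpa using one_sub_zpow_mul_ne_zero hx 0
  have e1 := qPoch_mul_shift (q := q) x n
  have e2 := qPoch_inv_shift (q := q) x n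
  have e3 : (x - q ^ n) * qPoch x⁻¹ q n = -((1 - x) * qPoch (q / x) q n) := by
    generalize qPoch x⁻¹ q n = T at *
    field_simp at e2
    linear_combination e2
  refine mul_left_cancel₀ h1 ?_
  linear_combination (1 - x) * qPoch (q * x) q n * e3 - (1 - x) * qPoch (q / x) q n * e1

theorem div_mul_self (hq0 : q ≠ 0) (x : ℂ) : q / (q * x) = x⁻¹ := by
  rw [div_mul_eq_div_div, div_self hq0, one_div]

/-- The combined terms telescope as Y(n+1) - Y(n). The limit of Y gives the infinite products and
-Y(0) gives x + x². -/
theorem symPochSum_mul (hq0 : q ≠ 0) (hq : ‖q‖ < 1) {x : ℂ} (hx0 : x ≠ 0)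
    (hx : ∀ k : ℤ, x ≠ q ^ k) :
    symPochSum (q * x) q + x ^ 3 * symPochSum x q =
      (1 - x ^ 2) * (qPochInf x q * qPochInf (q / x) q) + x + x ^ 2 := by
  let Y : ℕ → ℂ := fun n => (1 - x ^ 2) * (qPoch x q n * qPoch (q / x) q n) / (1 - q ^ n / x)
  have hB (n : ℕ) : 1 - q ^ n / x ≠ 0 := by
    simpa using one_sub_zpow_div_ne_zero hx0 hx n
  have hs := (summable_symPoch hq (q * x) (q / (q * x))).hasSum.add
    ((summable_symPoch hq x (q / x)).hasSum.mul_left (x ^ 3))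
  have hterm (n : ℕ) : q ^ n * (qPoch (q * x) q n * qPoch (q / (q * x)) q n) +
      x ^ 3 * (q ^ n * (qPoch x q n * qPoch (q / x) q n)) = Y (n + 1) - Y n := by
    have hC : x - q ^ n ≠ 0 := sub_ne_zero.2 (by simpa using hx n)
    have e1 : qPoch (q * x) q n * qPoch x⁻¹ q n =
        -((1 - q ^ n * x) * (qPoch x q n * qPoch (q / x) q n)) / (x - q ^ n) := by
      rw [← qPoch_mul_qPoch_inv hx0 hx n]
      field_simp
    have e2 : Y (n + 1) = (1 - x ^ 2) * (qPoch x q n * qPoch (q / x) q n) * (1 - q ^ n * x) := by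
      have h2 := hB (n + 1)
      have h3 : q ^ n * (q / x) = q ^ (n + 1) / x := by rw [pow_succ]; ring
      simp only [Y]
      rw [qPoch_succ, qPoch_succ, h3, div_eq_iff h2]
      ring
    have e3 : Y n = (1 - x ^ 2) * (qPoch x q n * qPoch (q / x) q n) * x / (x - q ^ n) := by
      simp only [Y]
      rw [one_sub_div hx0]
      field_simp
    rw [div_mul_self hq0, e1, e2, e3]
    generalize qPoch x q n * qPoch (q / x) q n = T
    field_simp
    ring
  have hsum (N : ℕ) : ∑ n ∈ Finset.range N, (q ^ n * (qPoch (q * x) q n * qPoch (q / (q * x)) q n) +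
      x ^ 3 * (q ^ n * (qPoch x q n * qPoch (q / x) q n))) = Y N - Y 0 := by
    rw [Finset.sum_congr rfl fun n _ => hterm n, Finset.sum_range_sub]
  have hY0 : Y 0 = -(x + x ^ 2) := by
    have h1 : x - 1 ≠ 0 := sub_ne_zero.2 (by simpa using hx 0)
    simp only [Y, qPoch_zero, pow_zero]
    rw [one_sub_div hx0]
    field_simp
    ring
  have hlim : Tendsto Y atTop (𝓝 ((1 - x ^ 2) * (qPochInf x q * qPochInf (q / x) q))) := by
    have hpow : Tendsto (fun n : ℕ => q ^ n) atTop (𝓝 0) :=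
      tendsto_pow_atTop_nhds_zero_of_norm_lt_one hq
    have h : Tendsto Y atTop
        (𝓝 ((1 - x ^ 2) * (qPochInf x q * qPochInf (q / x) q) / (1 - 0 / x))) :=
      (((tendsto_qPoch hq x).mul (tendsto_qPoch hq (q / x))).const_mul (1 - x ^ 2)).div
        ((hpow.div_const x).const_sub 1) (by simp)
    simpa using h
  have h1 := hs.tendsto_sum_nat
  simp only [hsum] at h1
  have h2 := tendsto_nhds_unique h1 (hlim.sub_const (Y 0))
  rw [symPochSum, symPochSum, h2, hY0]
  ring

end SymPochSum

/-! ### Functional equation of the universal mock theta function -/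

section MockG

theorem mockGTerm_mul (hq0 : q ≠ 0) {x : ℂ} (hx0 : x ≠ 0) (hx : ∀ k : ℤ, x ≠ q ^ k)
    (n : ℕ) : mockGTerm (q * x) q n = -((x - q ^ n) / (1 - q ^ (n + 1) * x)) * mockGTerm x q n := by
  have h1 : 1 - x ≠ 0 := by simpa using one_sub_zpow_mul_ne_zero hx 0
  have hA (n : ℕ) : 1 - q ^ n * x ≠ 0 := by
    simpa using one_sub_zpow_mul_ne_zero hx n
  have hB (n : ℕ) : 1 - q ^ n / x ≠ 0 := by
    simpa using one_sub_zpow_div_ne_zero hx0 hx n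
  have hp : qPoch x q (n + 1) ≠ 0 := Finset.prod_ne_zero_iff.2 fun i _ => hA i
  have hp' : qPoch (q / x) q n ≠ 0 := Finset.prod_ne_zero_iff.2 fun i _ => by
    have := hB (i + 1)
    rwa [pow_succ, mul_div_assoc] at this
  have hC : x - q ^ n ≠ 0 := sub_ne_zero.2 (by simpa using hx n)
  have e1 : qPoch (q * x) q (n + 1) = (1 - q ^ (n + 1) * x) * qPoch x q (n + 1) / (1 - x) := by
    rw [← qPoch_mul_shift]; field_simp
  have e2 : qPoch x⁻¹ q n = (x - 1) * qPoch (q / x) q n / (x - q ^ n) := by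
    have := qPoch_inv_shift (q := q) x n
    field_simp at this ⊢
    linear_combination this
  have h3 := hA (n + 1)
  have h4 : x - 1 ≠ 0 := sub_ne_zero.2 (by simpa using hx 0)
  rw [mockGTerm, mockGTerm, div_mul_self hq0, e1, e2]
  field_simp
  ring

theorem summable_mockGTerm_of_ne_zpow (hq0 : q ≠ 0) (hq : ‖q‖ < 1) {x : ℂ} (hx0 : x ≠ 0)
    (hx : ∀ k : ℤ, x ≠ q ^ k) : Summable (mockGTerm x q) :=
  summable_mockGTerm hq0 hq (fun n => by simpa using one_sub_zpow_mul_ne_zero hx n) fun n => by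
    have := one_sub_zpow_div_ne_zero hx0 hx (n + 1 : ℕ)
    rwa [zpow_natCast, pow_succ, mul_div_assoc] at this

theorem mockGTerm_succ (hq0 : q ≠ 0) {x : ℂ} (hx0 : x ≠ 0) (hx : ∀ k : ℤ, x ≠ q ^ k) (n : ℕ) :
    mockGTerm x q (n + 1) * (1 - q ^ (n + 1) / x) =
      q ^ (2 * n + 1) / (1 - q ^ (n + 1) * x) * mockGTerm x q n := by
  have hA (n : ℕ) : 1 - q ^ n * x ≠ 0 := by
    simpa using one_sub_zpow_mul_ne_zero hx n
  have hB (n : ℕ) : 1 - q ^ n / x ≠ 0 := by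
    simpa using one_sub_zpow_div_ne_zero hx0 hx n
  have hp : qPoch x q (n + 1) ≠ 0 := Finset.prod_ne_zero_iff.2 fun i _ => hA i
  have hp' : qPoch (q / x) q n ≠ 0 := Finset.prod_ne_zero_iff.2 fun i _ => by
    have := hB (i + 1)
    rwa [pow_succ, mul_div_assoc] at this
  have e : q ^ n * (q / x) = q ^ (n + 1) / x := by rw [pow_succ]; ring
  have e' : q ^ ((n + 1) ^ 2) = q ^ (n ^ 2) * q ^ (2 * n + 1) := by rw [← pow_add]; congr 1; ring
  have h1 := hA (n + 1)
  have h2 := hB (n + 1)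
  rw [mockGTerm, mockGTerm, qPoch_succ x q (n + 1), qPoch_succ (q / x), e, e']
  generalize 1 - q ^ (n + 1) / x = B at *
  field_simp

/-- The terms telescope again, now with W tending to 0. The part (qx)⁻¹ of W(0) cancels against the
-1 in the definition of g(qx, q). -/
theorem mockG_mul (hq0 : q ≠ 0) (hq : ‖q‖ < 1) {x : ℂ} (hx0 : x ≠ 0)
    (hx : ∀ k : ℤ, x ≠ q ^ k) :
    mockG (q * x) q + x ^ 3 * mockG x q = -(x + x ^ 2) := by
  let W : ℕ → ℂ := fun n => (x ^ 2 - q⁻¹) * (mockGTerm x q n * (1 - q ^ n / x))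
  have hs0 := summable_mockGTerm_of_ne_zpow hq0 hq hx0 hx
  have hs := ((summable_mockGTerm_of_ne_zpow hq0 hq (mul_ne_zero hq0 hx0)
    (mul_ne_zpow hq0 hx)).hasSum.mul_left (q * x)⁻¹).add (hs0.hasSum.mul_left (x ^ 2))
  have hterm (n : ℕ) : (q * x)⁻¹ * mockGTerm (q * x) q n + x ^ 2 * mockGTerm x q n =
      W n - W (n + 1) := by
    have h1 : 1 - q ^ (n + 1) * x ≠ 0 := by
      exact_mod_cast one_sub_zpow_mul_ne_zero hx (n + 1 : ℕ)
    have e : q ^ (2 * n + 1) = q * (q ^ n) ^ 2 := by ring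
    simp only [W]
    rw [mockGTerm_mul hq0 hx0 hx, mockGTerm_succ hq0 hx0 hx, e]
    rw [pow_succ] at h1 ⊢
    generalize mockGTerm x q n = T
    generalize q ^ n = u at *
    generalize hB : 1 - u * q * x = B at *
    field_simp
    rw [← hB]
    ring
  have hsum (N : ℕ) : ∑ n ∈ Finset.range N, ((q * x)⁻¹ * mockGTerm (q * x) q n +
      x ^ 2 * mockGTerm x q n) = W 0 - W N := by
    rw [Finset.sum_congr rfl fun n _ => hterm n, Finset.sum_range_sub']
  have hW0 : W 0 = -x + (q * x)⁻¹ := by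
    have h1 : 1 - x ≠ 0 := by simpa using one_sub_zpow_mul_ne_zero hx 0
    simp only [W, mockGTerm, qPoch, zero_add, Finset.prod_range_one, Finset.prod_range_zero]
    norm_num
    field_simp
    ring
  have hlim : Tendsto W atTop (𝓝 0) := by
    have hpow : Tendsto (fun n : ℕ => q ^ n) atTop (𝓝 0) :=
      tendsto_pow_atTop_nhds_zero_of_norm_lt_one hq
    simpa using (hs0.tendsto_atTop_zero.mul ((hpow.div_const x).const_sub 1)).const_mul
      (x ^ 2 - q⁻¹)
  have h1 := hs.tendsto_sum_nat
  simp only [hsum] at h1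
  have h2 := tendsto_nhds_unique h1 (hlim.const_sub (W 0))
  rw [sub_zero, hW0] at h2
  rw [mockG, mockG]
  have h3 : x ^ 3 * (x⁻¹ * (-1 + ∑' n, mockGTerm x q n)) = x ^ 2 * (-1 + ∑' n, mockGTerm x q n) := by
    field_simp
  rw [h3]
  linear_combination h2

end MockG

/-! ### Functional equation of the Appell–Lerch part -/

section LerchPart

/-- Shifting y = qx back to x changes w from q/x to 1/x; two splittings of the denominator then
raise w to q²/x, each leaving a multiple of j(x; q). -/
theorem lerchSeries_inv_mul (hq0 : q ≠ 0) (hq : ‖q‖ < 1) {x : ℂ} (hx0 : x ≠ 0)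
    (hx : ∀ k : ℤ, x ≠ q ^ k) :
    lerchSeries q (q ^ 2 / (q * x)) (q * x) + x ^ 3 * lerchSeries q (q ^ 2 / x) x =
      (1 - x ^ 2) * jTheta x q := by
  have hy := one_sub_zpow_mul_ne_zero hx
  have e0 : q ^ 2 / (q * x) = q / x := by field_simp
  have e1 : q / x / q = x⁻¹ := by field_simp
  have e2 : q * x⁻¹ = q / x := rfl
  have e3 : q * (q / x) = q ^ 2 / x := by ring
  have e4 : q / (q / x) = x := by field_simp
  rw [e0, lerchSeries_mul hq0 (div_ne_zero hq0 hx0), e1, e4,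
    lerchSeries_eq_add hq0 hq (inv_ne_zero hx0) hx0 hy, e2,
    lerchSeries_eq_add hq0 hq (div_ne_zero hq0 hx0) hx0 hy, e3, jTheta_inv hq hx0,
    jTheta_div hq0 hx0]
  field_simp
  ring

end LerchPart

/-! ### The main identity -/

section Identity

/-- The defect of the identity `∑ q^n (x; q)_n (q/x; q)_n + g(x, q) = ...`, multiplied by
`(x; q)_∞ (q/x; q)_∞` and extended holomorphically to `ℂ \ {0}`. -/
noncomputable def identityDefect (q x : ℂ) : ℂ :=
  qPochInf x q * qPochInf (q / x) q * symPochSum x q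
    + x⁻¹ * (-(qPochInf x q * qPochInf (q / x) q)
      + ∑' n : ℕ, q ^ (n ^ 2) * (qPochInf (q ^ (n + 1) * x) q * qPochInf (q ^ n * (q / x)) q))
    - lerchEntire q (q ^ 2 / x) x / qPochInf q q

theorem identityDefect_eq (hq0 : q ≠ 0) (hq : ‖q‖ < 1) {x : ℂ} (hx0 : x ≠ 0)
    (hx : ∀ k : ℤ, x ≠ q ^ k) :
    identityDefect q x = qPochInf x q * qPochInf (q / x) q *
      (symPochSum x q + mockG x q - lerchSeries q (q ^ 2 / x) x / qPochInf q q) := by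
  have hA (n : ℕ) : 1 - q ^ n * x ≠ 0 := by
    simpa using one_sub_zpow_mul_ne_zero hx n
  have hB (n : ℕ) : 1 - q ^ n * (q / x) ≠ 0 := by
    have := one_sub_zpow_div_ne_zero hx0 hx (n + 1 : ℕ)
    rwa [zpow_natCast, pow_succ, mul_div_assoc] at this
  have e (n : ℕ) : q ^ (n ^ 2) * (qPochInf (q ^ (n + 1) * x) q * qPochInf (q ^ n * (q / x)) q) =
      qPochInf x q * qPochInf (q / x) q * mockGTerm x q n := by
    have hp : qPoch x q (n + 1) ≠ 0 := Finset.prod_ne_zero_iff.2 fun i _ => hA i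
    have hp' : qPoch (q / x) q n ≠ 0 := Finset.prod_ne_zero_iff.2 fun i _ => hB i
    rw [mockGTerm, qPochInf_eq_qPoch_mul hq x (n + 1), qPochInf_eq_qPoch_mul hq (q / x) n]
    field_simp
  rw [identityDefect, tsum_congr e, tsum_mul_left,
    lerchEntire_eq hq0 hq _ hx0 (one_sub_zpow_mul_ne_zero hx), mockG]
  ring

/-- The inhomogeneous parts of the three functional equations cancel, leaving multiplier -x³; the
prefactor contributes -x⁻¹. -/
theorem identityDefect_mul (hq0 : q ≠ 0) (hq : ‖q‖ < 1) {x : ℂ} (hx0 : x ≠ 0)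
    (hx : ∀ k : ℤ, x ≠ q ^ k) : identityDefect q (q * x) = x ^ 2 * identityDefect q x := by
  have h1 := symPochSum_mul hq0 hq hx0 hx
  have h2 := mockG_mul hq0 hq hx0 hx
  have h3 := lerchSeries_inv_mul hq0 hq hx0 hx
  have hφ := qPochInf_self_ne_zero hq
  have h4 : qPochInf (q * x) q * qPochInf (q / (q * x)) q =
      -x⁻¹ * (qPochInf x q * qPochInf (q / x) q) := by
    have := jTheta_mul hq0 hq hx0
    rw [jTheta, jTheta, ← mul_assoc] at this
    exact mul_right_cancel₀ hφ this
  have h5 : symPochSum (q * x) q + mockG (q * x) q -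
      lerchSeries q (q ^ 2 / (q * x)) (q * x) / qPochInf q q = -x ^ 3 *
      (symPochSum x q + mockG x q - lerchSeries q (q ^ 2 / x) x / qPochInf q q) := by
    rw [jTheta] at h3
    have h3' : lerchSeries q (q ^ 2 / (q * x)) (q * x) / qPochInf q q =
        (1 - x ^ 2) * (qPochInf x q * qPochInf (q / x) q)
          - x ^ 3 * (lerchSeries q (q ^ 2 / x) x / qPochInf q q) := by
      have h6 := div_mul_cancel₀ (lerchSeries q (q ^ 2 / x) x) hφ
      rw [div_eq_iff hφ]
      linear_combination h3 + x ^ 3 * h6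
    rw [h3']
    linear_combination h1 + h2
  rw [identityDefect_eq hq0 hq (mul_ne_zero hq0 hx0) (mul_ne_zpow hq0 hx), h4, h5,
    identityDefect_eq hq0 hq hx0 hx]
  field_simp

theorem differentiableAt_qPoch (q : ℂ) (n : ℕ) {f : ℂ → ℂ} {x : ℂ} (hf : DifferentiableAt ℂ f x) :
    DifferentiableAt ℂ (fun x => qPoch (f x) q n) x := by
  unfold qPoch
  fun_prop

theorem norm_pow_mul_le (hq : ‖q‖ < 1) (n : ℕ) (x : ℂ) : ‖q ^ n * x‖ ≤ ‖x‖ := by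
  rw [norm_mul, norm_pow]
  exact mul_le_of_le_one_left (norm_nonneg _) (pow_le_one₀ (norm_nonneg q) hq.le)

theorem summable_norm_pow_sq (hq : ‖q‖ < 1) : Summable fun n : ℕ => ‖q‖ ^ (n ^ 2) :=
  (summable_geometric_of_lt_one (norm_nonneg q) hq).of_nonneg_of_le (fun _ => by positivity)
    fun n => pow_le_pow_of_le_one (norm_nonneg q) hq.le (Nat.le_self_pow two_ne_zero n)

theorem differentiableOn_identityDefect (hq0 : q ≠ 0) (hq : ‖q‖ < 1) :
    DifferentiableOn ℂ (identityDefect q) {0}ᶜ := by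
  intro x₀ hx₀
  have hx₀' : x₀ ≠ 0 := hx₀
  refine DifferentiableAt.differentiableWithinAt ?_
  obtain ⟨R, hR⟩ := exists_norm_and_norm_inv_bound_nhds (continuousAt_id (x := x₀)) hx₀'
  have hR := hR R le_rfl
  have h1q : 0 < 1 - ‖q‖ := sub_pos.2 hq
  set E := Real.exp (R / (1 - ‖q‖))
  have hexp {y : ℂ} (hy : ‖y‖ ≤ R) : Real.exp (‖y‖ / (1 - ‖q‖)) ≤ E :=
    Real.exp_le_exp.2 (div_le_div_of_nonneg_right hy h1q.le)
  have hdiv {x : ℂ} (h : ‖x⁻¹‖ ≤ R) : ‖q / x‖ ≤ R := by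
    rw [div_eq_mul_inv]
    simpa using (norm_pow_mul_le hq 1 x⁻¹).trans (by simpa using h)
  have hd {x : ℂ} (hx : x ≠ 0) : DifferentiableAt ℂ (fun x => q / x) x :=
    (differentiableAt_const q).div differentiableAt_id hx
  have d1 : DifferentiableAt ℂ (fun x => symPochSum x q) x₀ := by
    refine differentiableAt_tsum_of_dominated isOpen_compl_zero (fun n x hx => ?_)
      ((summable_geometric_of_lt_one (norm_nonneg q) hq).mul_right (E * E)) hx₀ ?_
    · exact (((differentiableAt_qPoch q n differentiableAt_id).mul
        (differentiableAt_qPoch q n (hd hx))).const_mul _).differentiableWithinAt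
    · filter_upwards [hR] with x ⟨_, h1, h2⟩ n
      rw [norm_mul, norm_mul, norm_pow]
      exact mul_le_mul_of_nonneg_left (mul_le_mul ((norm_qPoch_le hq _ n).trans (hexp h1))
        ((norm_qPoch_le hq _ n).trans (hexp (hdiv h2))) (norm_nonneg _) (Real.exp_pos _).le)
        (by positivity)
  have d2 : DifferentiableAt ℂ (fun x => ∑' n : ℕ, q ^ (n ^ 2) *
      (qPochInf (q ^ (n + 1) * x) q * qPochInf (q ^ n * (q / x)) q)) x₀ := by
    refine differentiableAt_tsum_of_dominated isOpen_compl_zero (fun n x hx => ?_)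
      ((summable_norm_pow_sq hq).mul_right (E * E)) hx₀ ?_
    · refine DifferentiableAt.differentiableWithinAt (.const_mul (.mul ?_ ?_) _)
      · exact DifferentiableAt.fun_comp' x (differentiable_qPochInf hq _)
          (differentiableAt_id.const_mul _)
      · exact DifferentiableAt.fun_comp' x (differentiable_qPochInf hq _) ((hd hx).const_mul _)
    · filter_upwards [hR] with x ⟨_, h1, h2⟩ n
      rw [norm_mul, norm_mul, norm_pow]
      refine mul_le_mul_of_nonneg_left (mul_le_mul ((norm_qPochInf_le hq _).trans (hexp ?_))
        ((norm_qPochInf_le hq _).trans (hexp ?_)) (norm_nonneg _) (Real.exp_pos _).le)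
        (by positivity)
      · exact (norm_pow_mul_le hq _ _).trans h1
      · exact (norm_pow_mul_le hq _ _).trans (hdiv h2)
  have hd2 {x : ℂ} (hx : x ≠ 0) : DifferentiableAt ℂ (fun x => q ^ 2 / x) x :=
    (differentiableAt_const (q ^ 2)).div differentiableAt_id hx
  have d3 : DifferentiableAt ℂ (fun x => lerchEntire q (q ^ 2 / x) x) x₀ := by
    refine (differentiableOn_lerchEntire hq0 hq (w := fun x => q ^ 2 / x) (y := fun x => x)
      (fun x hx => (hd2 hx).differentiableWithinAt)
      (fun x hx => div_ne_zero (pow_ne_zero 2 hq0) hx) differentiableOn_id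
      (fun x hx => hx) x₀ hx₀).differentiableAt (isOpen_compl_zero.mem_nhds hx₀)
  have dφ := (differentiable_qPochInf hq x₀).mul (differentiableAt_qPochInf_div hq q hx₀')
  exact ((dφ.mul d1).add ((differentiableAt_id.inv hx₀').mul (dφ.neg.add d2))).sub
    (d3.div_const _)

/-- The theta factors have joint multiplier (s t x²)⁻¹ = -x⁻², so the product is antiperiodic. -/
theorem identityDefect_mul_jTheta_eq_zero (hq0 : q ≠ 0) (hq : ‖q‖ < 1) {s t : ℂ} (hst : s * t = -1)
    {x : ℂ} (hx : x ≠ 0) : identityDefect q x * (jTheta (s * x) q * jTheta (t * x) q) = 0 := by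
  have hs : s ≠ 0 := by rintro rfl; simp at hst
  have ht : t ≠ 0 := by rintro rfl; simp at hst
  have hj {s : ℂ} (hs : s ≠ 0) : DifferentiableOn ℂ (fun x => jTheta (s * x) q) {0}ᶜ :=
    fun x hx => (DifferentiableAt.fun_comp' x (differentiableAt_jTheta hq (mul_ne_zero hs hx))
      (differentiableAt_id.const_mul s)).differentiableWithinAt
  refine eq_zero_of_antiperiodic (S := {x | ∃ k : ℤ, x = q ^ k * 1}) hq0 hq
    (H := fun x => identityDefect q x * (jTheta (s * x) q * jTheta (t * x) q))
    ((differentiableOn_identityDefect hq0 hq).mul ((hj hs).mul (hj ht)))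
    (countable_zpow_mul q 1) (fun x hx hxS => ?_) hx
  have hxk : ∀ k : ℤ, x ≠ q ^ k := fun k hk => hxS ⟨k, by rw [mul_one]; exact hk⟩
  simp only [mul_left_comm _ q x]
  rw [identityDefect_mul hq0 hq hx hxk, jTheta_mul hq0 hq (mul_ne_zero hs hx),
    jTheta_mul hq0 hq (mul_ne_zero ht hx), mul_inv, mul_inv]
  have e : s⁻¹ * t⁻¹ = -1 := by rw [← mul_inv, hst]; norm_num
  have e' : x ^ 2 * (x⁻¹ * x⁻¹) = 1 := by field_simp
  linear_combination (identityDefect q x * (jTheta (s * x) q * jTheta (t * x) q)) *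
    (x ^ 2 * (x⁻¹ * x⁻¹) * e - e')

theorem symPochSum_eq (hq0 : q ≠ 0) (hq : ‖q‖ < 1) {x : ℂ} (hx0 : x ≠ 0)
    (hx : ∀ k : ℤ, x ≠ q ^ k) :
    symPochSum x q = -mockG x q + lerchSeries q (q ^ 2 / x) x / qPochInf q q := by
  have hD : identityDefect q x = 0 := by
    by_cases hneg : ∀ k : ℤ, -x ≠ q ^ k
    · have h := identityDefect_mul_jTheta_eq_zero hq0 hq (s := 1) (t := -1) (by norm_num) hx0
      rw [one_mul, neg_one_mul] at h
      exact (mul_eq_zero.1 h).resolve_right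
        (mul_ne_zero (jTheta_ne_zero hq hx0 hx) (jTheta_ne_zero hq (neg_ne_zero.2 hx0) hneg))
    -- If -x is a power of q, the choice s = 1, t = -1 is useless at x, and s = t = i serves
    -- instead: were ix also a power of q, comparing moduli would give the same exponent, hence i =
    -- -1.
    · push Not at hneg
      obtain ⟨k, hk⟩ := hneg
      have hI : ∀ l : ℤ, Complex.I * x ≠ q ^ l := by
        intro l hl
        have h1 : ‖q‖ ^ k = ‖q‖ ^ l := by
          rw [← norm_zpow, ← norm_zpow, ← hk, ← hl]; simp
        have h2 := zpow_right_injective₀ (norm_pos_iff.2 hq0) hq.ne h1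
        rw [← h2, ← hk] at hl
        have h3 : (Complex.I + 1) * x = 0 := by linear_combination hl
        rcases mul_eq_zero.1 h3 with h4 | h4
        · have := congrArg Complex.re h4
          simp at this
        · exact hx0 h4
      have h := identityDefect_mul_jTheta_eq_zero hq0 hq Complex.I_mul_I hx0
      have hj := jTheta_ne_zero hq (mul_ne_zero Complex.I_ne_zero hx0) hI
      exact (mul_eq_zero.1 h).resolve_right (mul_ne_zero hj hj)
  rw [identityDefect_eq hq0 hq hx0 hx] at hD
  have hj := jTheta_ne_zero hq hx0 hx
  have h := (mul_eq_zero.1 hD).resolve_left (left_ne_zero_of_mul hj)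
  linear_combination h

end Identity

/-! ### Changing the variable z of an Appell–Lerch sum -/

section ChangeOfVariable

/-- The defect of the formula that relates two Appell--Lerch sums, with its denominators cleared
and extended holomorphically to `ℂ \ {0}`. -/
noncomputable def changeDefect (q z u : ℂ) : ℂ :=
  -(z * jTheta (-1) q * (qPochInf q q * lerchEntire q (q * z) u) * jTheta (-(u / z)) q)
    - jTheta z q * (qPochInf q q * lerchEntire q (-q) (-(u / z))) * jTheta u q
    + qPochInf q q ^ 3 * jTheta (-z) q * jTheta (-u) q

theorem changeDefect_eq (hq0 : q ≠ 0) (hq : ‖q‖ < 1) {z u : ℂ} (hz : z ≠ 0) (hu : u ≠ 0)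
    (hu1 : ∀ k : ℤ, u ≠ q ^ k) (hu2 : ∀ k : ℤ, -(u / z) ≠ q ^ k) :
    changeDefect q z u = -(jTheta u q * jTheta (-(u / z)) q *
      (z * jTheta (-1) q * lerchSeries q (q * z) u + jTheta z q * lerchSeries q (-q) (-(u / z))))
      + qPochInf q q ^ 3 * jTheta (-z) q * jTheta (-u) q := by
  have hv : -(u / z) ≠ 0 := neg_ne_zero.2 (div_ne_zero hu hz)
  rw [changeDefect, ← jTheta_mul_lerchSeries hq0 hq _ hu (one_sub_zpow_mul_ne_zero hu1),
    ← jTheta_mul_lerchSeries hq0 hq _ hv (one_sub_zpow_mul_ne_zero hu2)]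
  ring

/-- The theta functions j(z) and j(-1) split off by the two shifted series enter with opposite signs
and cancel, so the equation in u is homogeneous. -/
theorem changeDefect_mul (hq0 : q ≠ 0) (hq : ‖q‖ < 1) {z u : ℂ} (hz : z ≠ 0) (hu : u ≠ 0)
    (hu1 : ∀ k : ℤ, u ≠ q ^ k) (hu2 : ∀ k : ℤ, -(u / z) ≠ q ^ k) :
    changeDefect q z (q * u) = u⁻¹ * changeDefect q z u := by
  have hv : -(u / z) ≠ 0 := neg_ne_zero.2 (div_ne_zero hu hz)
  have e : -(q * u / z) = q * -(u / z) := by ring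
  have h1 : lerchSeries q (q * z) (q * u) =
      -z⁻¹ * (jTheta z q + u * lerchSeries q (q * z) u) := by
    rw [lerchSeries_mul hq0 (mul_ne_zero hq0 hz), mul_div_cancel_left₀ _ hq0,
      lerchSeries_eq_add hq0 hq hz hu (one_sub_zpow_mul_ne_zero hu1), div_mul_self hq0]
  have h2 : lerchSeries q (-q) (q * -(u / z)) =
      jTheta (-1) q + -(u / z) * lerchSeries q (-q) (-(u / z)) := by
    rw [lerchSeries_mul hq0 (neg_ne_zero.2 hq0), neg_div, div_self hq0,
      lerchSeries_eq_add hq0 hq (by norm_num) hv (one_sub_zpow_mul_ne_zero hu2), mul_neg_one,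
      div_neg, div_self hq0, neg_neg, one_mul]
  rw [changeDefect_eq hq0 hq hz (mul_ne_zero hq0 hu) (mul_ne_zpow hq0 hu1)
      (by rw [e]; exact mul_ne_zpow hq0 hu2), changeDefect_eq hq0 hq hz hu hu1 hu2, e, h1, h2,
    ← mul_neg q u, jTheta_mul hq0 hq hu, jTheta_mul hq0 hq hv, jTheta_mul hq0 hq (neg_ne_zero.2 hu)]
  generalize lerchSeries q (q * z) u = L1
  generalize lerchSeries q (-q) (-(u / z)) = L2
  generalize jTheta (-(u / z)) q = j1
  field_simp
  ring

theorem differentiableOn_changeDefect (hq0 : q ≠ 0) (hq : ‖q‖ < 1) {z : ℂ} (hz : z ≠ 0) :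
    DifferentiableOn ℂ (changeDefect q z) {0}ᶜ := by
  have hv {u : ℂ} (hu : u ≠ 0) : -(u / z) ≠ 0 := neg_ne_zero.2 (div_ne_zero hu hz)
  have dv : DifferentiableOn ℂ (fun u : ℂ => -(u / z)) {0}ᶜ := by fun_prop
  have dj {f : ℂ → ℂ} (hf : DifferentiableOn ℂ f {0}ᶜ) (hf0 : ∀ u, u ≠ 0 → f u ≠ 0) :
      DifferentiableOn ℂ (fun u => jTheta (f u) q) {0}ᶜ := fun u hu =>
    (DifferentiableAt.fun_comp' u (differentiableAt_jTheta hq (hf0 u hu))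
      ((hf u hu).differentiableAt (isOpen_compl_zero.mem_nhds hu))).differentiableWithinAt
  have d1 := differentiableOn_lerchEntire hq0 hq (w := fun _ => q * z) (y := fun u => u)
    (differentiableOn_const _) (fun _ _ => mul_ne_zero hq0 hz) differentiableOn_id
    fun _ hu => hu
  have d2 := differentiableOn_lerchEntire hq0 hq (w := fun _ => -q) (y := fun u => -(u / z))
    (differentiableOn_const _) (fun _ _ => neg_ne_zero.2 hq0) dv fun _ hu => hv hu
  have d3 := dj differentiableOn_id fun _ hu => hu
  have d4 := dj dv fun _ hu => hv hu
  have d5 := dj differentiableOn_id.neg fun _ hu => neg_ne_zero.2 hu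
  exact (((((d1.const_mul (qPochInf q q)).const_mul (z * jTheta (-1) q)).mul d4).neg).sub
    (((d2.const_mul (qPochInf q q)).const_mul (jTheta z q)).mul d3)).add (d5.const_mul _)

/-- The middle term carries j(1; q) = 0, and the value of `lerchEntire` at 1 makes the other two
cancel. -/
theorem changeDefect_one (hq0 : q ≠ 0) (hq : ‖q‖ < 1) {z : ℂ} (hz : z ≠ 0) :
    changeDefect q z 1 = 0 := by
  have e : -(1 / z) = (-z)⁻¹ := by rw [inv_neg, one_div]
  rw [changeDefect, lerchEntire_one hq0 hq, jTheta_one hq, e, jTheta_inv hq (neg_ne_zero.2 hz)]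
  field_simp
  ring

theorem changeDefect_eq_zero (hq0 : q ≠ 0) (hq : ‖q‖ < 1) {z u : ℂ} (hz : z ≠ 0) (hu : u ≠ 0) :
    changeDefect q z u = 0 := by
  refine eq_zero_of_quasiperiodic (S := {x | ∃ k : ℤ, x = q ^ k * 1} ∪ {x | ∃ k : ℤ, x = q ^ k * -z})
    hq0 hq (differentiableOn_changeDefect hq0 hq hz)
    ((countable_zpow_mul q 1).union (countable_zpow_mul q (-z))) (fun u hu huS => ?_)
    (changeDefect_one hq0 hq hz) hu
  refine changeDefect_mul hq0 hq hz hu (fun k hk => huS (.inl ⟨k, by rw [mul_one]; exact hk⟩))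
    fun k hk => huS (.inr ⟨k, ?_⟩)
  rw [← hk]
  field_simp

/-- The change of the variable `z` to `-1` in the Appell--Lerch sum. -/
theorem lerchSeries_change (hq0 : q ≠ 0) (hq : ‖q‖ < 1) {z u : ℂ} (hz : z ≠ 0) (hu : u ≠ 0)
    (hu1 : ∀ k : ℤ, u ≠ q ^ k) (hu2 : ∀ k : ℤ, -(u / z) ≠ q ^ k) :
    jTheta u q * jTheta (-(u / z)) q *
      (z * jTheta (-1) q * lerchSeries q (q * z) u + jTheta z q * lerchSeries q (-q) (-(u / z))) =
      qPochInf q q ^ 3 * jTheta (-z) q * jTheta (-u) q := by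
  have h := changeDefect_eq_zero hq0 hq hz hu
  rw [changeDefect_eq hq0 hq hz hu hu1 hu2] at h
  linear_combination -h

end ChangeOfVariable

/-! ### Theta product identities -/

section ThetaProducts

theorem jTheta_neg_one_mul (hq : ‖q‖ < 1) :
    jTheta (-1) q * qPochInf q q = 2 * qPochInf (q ^ 2) (q ^ 2) ^ 2 := by
  rw [← qPochInf_mul_neg hq q, jTheta, qPochInf_step hq (-1), mul_neg_one, div_neg, div_one]
  ring

theorem jTheta_mul_jTheta_neg (hq : ‖q‖ < 1) (x : ℂ) :
    jTheta x q * jTheta (-x) q = qPochInf (x ^ 2) (q ^ 2) * qPochInf (q ^ 2 / x ^ 2) (q ^ 2) *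
      qPochInf q q ^ 2 := by
  rw [jTheta, jTheta, div_neg, ← div_pow, ← qPochInf_mul_neg hq x, ← qPochInf_mul_neg hq (q / x)]
  ring

/-- The pair j(±aq; q²) becomes products in base q⁴, which supply the odd factors missing from j(a²;
q⁴) to form j(a²; q²). Pairing that with j(-a²; q²) gives base q⁴ at a⁴. -/
theorem jTheta_product (hq0 : q ≠ 0) (hq : ‖q‖ < 1) {a : ℂ} (ha : a ≠ 0) :
    jTheta (a * q) (q ^ 2) * jTheta (-(a * q)) (q ^ 2) * jTheta (-a ^ 2) (q ^ 2) *
      jTheta (a ^ 2) (q ^ 4) = qPochInf (q ^ 2) (q ^ 2) ^ 3 * jTheta (a ^ 4) (q ^ 4) := by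
  have h2 := norm_sq_lt_one hq
  have h4 : (q ^ 2) ^ 2 = q ^ 4 := by ring
  have e1 := jTheta_mul_jTheta_neg h2 (a * q)
  have e2 := jTheta_mul_jTheta_neg h2 (a ^ 2)
  have e3 := qPochInf_even_mul_odd h2 (a ^ 2)
  have e4 := qPochInf_even_mul_odd h2 (q ^ 2 / a ^ 2)
  have f1 : (a * q) ^ 2 = q ^ 2 * a ^ 2 := by ring
  have f2 : q ^ 4 / (q ^ 2 * a ^ 2) = q ^ 2 / a ^ 2 := by field_simp
  have f3 : q ^ 2 * (q ^ 2 / a ^ 2) = q ^ 4 / a ^ 2 := by ring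
  have f4 : (a ^ 2) ^ 2 = a ^ 4 := by ring
  rw [h4, f1, f2] at e1
  rw [h4, f4] at e2
  rw [h4] at e3
  rw [h4, f3] at e4
  rw [e1]
  have e5 : jTheta (a ^ 2) (q ^ 4) = qPochInf (a ^ 2) (q ^ 4) * qPochInf (q ^ 4 / a ^ 2) (q ^ 4) *
    qPochInf (q ^ 4) (q ^ 4) := rfl
  have e6 : jTheta (a ^ 4) (q ^ 4) = qPochInf (a ^ 4) (q ^ 4) * qPochInf (q ^ 4 / a ^ 4) (q ^ 4) *
    qPochInf (q ^ 4) (q ^ 4) := rfl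
  have e7 : jTheta (a ^ 2) (q ^ 2) = qPochInf (a ^ 2) (q ^ 2) * qPochInf (q ^ 2 / a ^ 2) (q ^ 2) *
    qPochInf (q ^ 2) (q ^ 2) := rfl
  rw [e7, ← e3, ← e4] at e2
  rw [e5, e6]
  linear_combination (qPochInf (q ^ 2) (q ^ 2) * qPochInf (q ^ 4) (q ^ 4)) * e2

end ThetaProducts

end QSeries

open QSeries

/-! ### The two formulas -/

theorem mainTheorem5 (q a : ℂ) (hq0 : q ≠ 0) (hq : ‖q‖ < 1) (ha : a ≠ 0) :
    ((∀ k : ℤ, a ^ 4 ≠ q ^ (4 * k)) →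
      HasSum
        (fun n : ℕ => q ^ (2 * n + 1) *
          (QSeries.qPoch (-a * q) (q ^ 2) n * QSeries.qPoch (-q / a) (q ^ 2) n))
        (-q * QSeries.mockG (-a * q) (q ^ 2)
          + a * (QSeries.jTheta (-a * q) (q ^ 2) / QSeries.bigJ 2 q) *
              QSeries.appellLerch (a ^ 2) (q ^ 2) (-1)
          - 1 / 2 * (a * QSeries.jTheta (a * q) (q ^ 2) ^ 3 * QSeries.jTheta (a ^ 2) (q ^ 4) /
              (QSeries.bigJ 4 q ^ 2 * QSeries.jTheta (a ^ 4) (q ^ 4))))) ∧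
    ((∀ k : ℤ, a ≠ -q ^ (2 * k + 1)) →
      HasSum
        (fun n : ℕ => q ^ (2 * n + 1) *
          (QSeries.qPoch (-a * q) (q ^ 2) n * QSeries.qPoch (-q / a) (q ^ 2) n))
        (-q * QSeries.mockG (-a * q) (q ^ 2)
          + a * (QSeries.jTheta (-a * q) (q ^ 2) / QSeries.bigJ 2 q) *
              QSeries.appellLerch (a ^ 2) (q ^ 2) (-a⁻¹ * q))) := by
  have hQ := norm_sq_lt_one hq
  have hQ0 : q ^ 2 ≠ 0 := pow_ne_zero 2 hq0
  have hX0 : -a * q ≠ 0 := mul_ne_zero (neg_ne_zero.2 ha) hq0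
  have hz0 : -q / a ≠ 0 := div_ne_zero (neg_ne_zero.2 hq0) ha
  have hdiv : q ^ 2 / (-a * q) = -q / a := by field_simp
  have hzpow (k : ℤ) : (q ^ 2) ^ k = q ^ (2 * k) := by rw [zpow_mul]; norm_cast
  have hφ := qPochInf_self_ne_zero hQ
  have hW : (q ^ 2) ^ 2 / (-a * q) = q ^ 2 * (-q / a) := by field_simp
  have main (hX : ∀ k : ℤ, -a * q ≠ (q ^ 2) ^ k) :
      HasSum
        (fun n : ℕ => q ^ (2 * n + 1) * (qPoch (-a * q) (q ^ 2) n * qPoch (-q / a) (q ^ 2) n))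
        (-q * mockG (-a * q) (q ^ 2) +
          q * (lerchSeries (q ^ 2) (q ^ 2 * (-q / a)) (-a * q) / qPochInf (q ^ 2) (q ^ 2))) := by
    have h := ((summable_symPoch hQ (-a * q) (q ^ 2 / (-a * q))).hasSum).mul_left q
    rw [← symPochSum, symPochSum_eq hQ0 hQ hX0 hX, hdiv, hW] at h
    rw [show -q * mockG (-a * q) (q ^ 2) +
        q * (lerchSeries (q ^ 2) (q ^ 2 * (-q / a)) (-a * q) / qPochInf (q ^ 2) (q ^ 2)) =
        q * (-mockG (-a * q) (q ^ 2) +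
          lerchSeries (q ^ 2) (q ^ 2 * (-q / a)) (-a * q) / qPochInf (q ^ 2) (q ^ 2)) by ring]
    have e : (fun n : ℕ => q ^ (2 * n + 1) *
        (qPoch (-a * q) (q ^ 2) n * qPoch (-q / a) (q ^ 2) n)) = fun n =>
        q * ((q ^ 2) ^ n * (qPoch (-a * q) (q ^ 2) n * qPoch (-q / a) (q ^ 2) n)) :=
      funext fun n => by ring
    rw [e]
    exact h
  refine ⟨fun h => ?_, fun h => ?_⟩
  · have hX : ∀ k : ℤ, -a * q ≠ (q ^ 2) ^ k := fun k hk => h (2 * k - 1) <| by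
      have e : q ^ (4 * (2 * k - 1)) * q ^ 4 = ((q ^ 2) ^ k) ^ 4 := by
        rw [hzpow, ← zpow_natCast, ← zpow_natCast, ← zpow_mul, ← zpow_add₀ hq0]
        congr 1
        push_cast
        ring
      rw [← hk] at e
      refine mul_right_cancel₀ (pow_ne_zero 4 hq0) (e.trans ?_).symm
      ring
    have hv : ∀ k : ℤ, -a ^ 2 ≠ (q ^ 2) ^ k := fun k hk => h k <| by
      have e : q ^ (4 * k) = ((q ^ 2) ^ k) ^ 2 := by
        rw [hzpow, ← zpow_natCast, ← zpow_mul]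
        congr 1
        push_cast
        ring
      rw [e, ← hk]
      ring
    have hq4 : ‖q ^ 4‖ < 1 := by rw [norm_pow]; exact pow_lt_one₀ (norm_nonneg q) hq (by norm_num)
    have n1 := jTheta_ne_zero hQ hX0 hX
    have n2 := jTheta_ne_zero hQ (neg_ne_zero.2 (pow_ne_zero 2 ha)) hv
    have n3 : jTheta (a ^ 4) (q ^ 4) ≠ 0 := jTheta_ne_zero hq4 (pow_ne_zero 4 ha) fun k hk =>
      h k (by rw [hk, zpow_mul]; norm_cast)
    have n4 : qPochInf (q ^ 4) (q ^ 4) ≠ 0 := qPochInf_self_ne_zero hq4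
    -- Here z = -q/a and u = -aq: then q²z is the parameter of the series in `main`, and -u/z = -a²
    -- leads to m(a², q², -1).
    have hvz : -(-a * q / (-q / a)) = -a ^ 2 := by field_simp
    have hc := lerchSeries_change hQ0 hQ hz0 hX0 hX (by rw [hvz]; exact hv)
    have hm : lerchSeries (q ^ 2) (-q ^ 2) (-a ^ 2) =
        jTheta (-1) (q ^ 2) * appellLerch (a ^ 2) (q ^ 2) (-1) := by
      have n5 : jTheta (-1) (q ^ 2) ≠ 0 := by
        refine left_ne_zero_of_mul (b := qPochInf (q ^ 2) (q ^ 2)) ?_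
        rw [jTheta_neg_one_mul hQ, show (q ^ 2) ^ 2 = q ^ 4 by ring]
        exact mul_ne_zero two_ne_zero (pow_ne_zero 2 n4)
      -- One shift moves y from -a² to -a²/q², the value in m(a², q², -1), and w from -q² to -1.
      have e : -a ^ 2 = q ^ 2 * (a ^ 2 * -1 / q ^ 2) := by field_simp
      rw [appellLerch_eq hQ0, e, lerchSeries_mul hQ0 (neg_ne_zero.2 hQ0), neg_div, div_self hQ0,
        div_neg, div_self hQ0]
      field_simp
    have hz1 : jTheta (-q / a) (q ^ 2) = jTheta (-a * q) (q ^ 2) := by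
      rw [← hdiv, jTheta_div hQ0 hX0]
    have hz2 : jTheta (-(-q / a)) (q ^ 2) = jTheta (a * q) (q ^ 2) := by
      rw [← jTheta_div hQ0 (mul_ne_zero ha hq0)]
      congr 1
      field_simp
    rw [hvz, hm, hz1, hz2, neg_mul, neg_neg, ← neg_mul] at hc
    have hp := jTheta_product hq0 hq ha
    have h1 := jTheta_neg_one_mul hQ
    rw [show (q ^ 2) ^ 2 = q ^ 4 by ring] at h1
    rw [← neg_mul] at hp
    refine (congrArg (HasSum _) ?_).mpr (main hX)
    rw [bigJ_eq_qPochInf, bigJ_eq_qPochInf]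
    generalize lerchSeries (q ^ 2) (q ^ 2 * (-q / a)) (-a * q) = L at *
    generalize appellLerch (a ^ 2) (q ^ 2) (-1) = m at *
    generalize jTheta (-1) (q ^ 2) = j1 at *
    generalize qPochInf (q ^ 2) (q ^ 2) = φ at *
    generalize qPochInf (q ^ 4) (q ^ 4) = J4 at *
    generalize jTheta (-a * q) (q ^ 2) = jX at *
    generalize jTheta (a * q) (q ^ 2) = jY at *
    generalize jTheta (-a ^ 2) (q ^ 2) = jV at *
    generalize jTheta (a ^ 2) (q ^ 4) = jU at *
    generalize jTheta (a ^ 4) (q ^ 4) = jW at *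
    have hK : jX * jV * j1 * (a * jX * m - q * L) = a * φ ^ 3 * jY ^ 2 := by
      field_simp at hc
      linear_combination hc
    -- The nonzero factors j(-aq; q²) and j(-a²; q²) are restored so that `hp` applies; `h1`
    -- eliminates j(-1; q²).
    have key : (a * jX * m - q * L) * (2 * J4 ^ 2) * jW = φ * a * jY ^ 3 * jU := by
      refine mul_left_cancel₀ (mul_ne_zero n1 n2) ?_
      linear_combination φ * jW * hK - jX * jV * (a * jX * m - q * L) * jW * h1
        - a * φ * jY ^ 2 * hp
    field_simp
    linear_combination key
  · have hX : ∀ k : ℤ, -a * q ≠ (q ^ 2) ^ k := fun k hk => h (k - 1) <| by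
      have e : q ^ (2 * (k - 1) + 1) * q = (q ^ 2) ^ k := by
        rw [hzpow, ← zpow_add_one₀ hq0]
        congr 1
        ring
      refine mul_right_cancel₀ hq0 ?_
      rw [neg_mul, e, ← hk]
      ring
    have n1 := jTheta_ne_zero hQ hX0 hX
    have hz : -a⁻¹ * q = -q / a := by ring
    have hz1 : jTheta (-q / a) (q ^ 2) = jTheta (-a * q) (q ^ 2) := by
      rw [← hdiv, jTheta_div hQ0 hX0]
    have hL : lerchSeries (q ^ 2) (q ^ 2 * (-q / a)) (-a * q) =
        a / q * lerchSeries (q ^ 2) (-q / a) (a ^ 2 * (-q / a) / q ^ 2) := by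
      -- With z = -q/a, the point -aq is q² times the value a²z/q² occurring in m(a², q², z), so one
      -- shift suffices and no theta quotient arises.
      have e : -a * q = q ^ 2 * (a ^ 2 * (-q / a) / q ^ 2) := by field_simp
      have e1 : q ^ 2 * (-q / a) / q ^ 2 = -q / a := by field_simp
      have e2 : q ^ 2 / (q ^ 2 * (-q / a)) = -(a / q) := by field_simp
      conv_lhs => rw [e]
      rw [lerchSeries_mul hQ0 (mul_ne_zero hQ0 hz0), e1, e2, neg_neg]
    refine (congrArg (HasSum _) ?_).mpr (main hX)
    rw [hz, appellLerch_eq hQ0, hL, hz1, bigJ_eq_qPochInf]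
    generalize lerchSeries (q ^ 2) (-q / a) (a ^ 2 * (-q / a) / q ^ 2) = L
    generalize jTheta (-a * q) (q ^ 2) = jX at *
    field_simp
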